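/- Let $y\sim N(\theta^*,I_n)$, where $\theta^*=\theta^{*(n)}\in\mathbb R^n$ is arbitrary with exactly $s=s_n\ge 1$ nonzero entries and $s/n\to0$ as $n\to\infty$. Let $\alpha>1$ and let $\pi_0$ be a fixed probability density on $\mathbb R$ that is strictly decreasing on $(0,\infty)$ and increasing on $(-\infty,0)$ and satisfies $C_1|x|^{-\alpha}\le\pi_0(x)\le C_2|x|^{-\alpha}$ for all $|x|>M$, for some constants $M>0$ and $0<C_1<C_2$. The density $\pi_0$ may be unbounded near $0$, but assume that $\pi_0(x)\le K|x|^{\beta-1}$ for $0<|x|\le1$, for some $\beta>0$ and some $K$ (which holds for instance if $\pi_0$ is bounded or has a logarithmic pole). Consider the prior $$\pi(\theta\mid\tau)=\prod_{i=1}^n\frac1\tau\,\pi_0\!\left(\frac{\theta_i}\tau\right),\qquad \tau\sim\pi_n(\tau),$$ where $\pi_n$ is a probability distribution that may depend on $n$, and let $\pi(\cdot\mid y)$ be the resulting posterior distribution of $\theta$. Let $\omega>0$ be such that $\alpha\le1+\omega/2$. Suppose that for some constant $c<1+\omega/2$ the distribution $\pi_n$ is supported on $[(1/n)^{c/(\alpha-1)},\infty)$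 for all large $n$, and that, as $n\to\infty$ (with $-\log 0=\infty$), $$\frac{-\log\pi_n\{(s/n)^{(1+\omega/2)/(\alpha-1)}\le\tau\le(s/n)^{\alpha/(\alpha-1)}\}}{s\log(n/s)}\to0,\qquad \frac{-\log\pi_n\{\tau\ge(s/n)^{\alpha/(\alpha-1)}\}}{s\log(n/s)}\to\infty .$$ Then, with no condition on the size of the entries of $\theta^*$, $$\lim_{n\to\infty}E^*\big[\pi\big(\|\theta-\theta^*\|_2\ge C_1(\omega)\sqrt{s\log n}\,\big|\,y\big)\big]=0,\qquad \lim_{n\to\infty}E^*\big[\pi\big(\|\theta-\theta^*\|_1\ge s\,C_2(\omega)\sqrt{\log n}\,\big|\,y\big)\big]=0,$$ where $E^*$ is the expectation over $y\sim N(\theta^*,I_n)$, $C_1(\omega)=\sqrt{2+\omega}+\sqrt\omega$ and $C_2(\omega)=\sqrt{2+\omega}+\sqrt{\omega^2/5}+\sqrt{\omega/5}$. -/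

import Mathlib

open Filter Topology MeasureTheory ProbabilityTheory
open scoped ENNReal

namespace SparseMeans

/-- `π0` is a probability density on the line, strictly decreasing on `(0, ∞)`, increasing on
`(-∞, 0)`, whose tails decay polynomially with order `α > 1`. No value at `0` is prescribed, and
`π0` may be unbounded near `0`. -/
structure IsPolyTailDensity (π0 : ℝ → ℝ) (α : ℝ) : Prop where
  measurable : Measurable π0
  nonneg : ∀ x, 0 ≤ π0 x
  lintegral_eq_one : ∫⁻ x, ENNReal.ofReal (π0 x) = 1
  strictAntiOn_pos : StrictAntiOn π0 (Set.Ioi 0)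
  monotoneOn_neg : MonotoneOn π0 (Set.Iio 0)
  one_lt_order : 1 < α
  tail : ∃ M C₁ C₂ : ℝ, 0 < M ∧ 0 < C₁ ∧ C₁ < C₂ ∧
    ∀ x : ℝ, M < |x| → C₁ * |x| ^ (-α) ≤ π0 x ∧ π0 x ≤ C₂ * |x| ^ (-α)

/-- Conditional prior density of `θ` given the global shrinkage `τ`:
`∏ i, (1 / τ) * π0 (θ i / τ)`. -/
noncomputable def priorDensity (π0 : ℝ → ℝ) {n : ℕ} (τ : ℝ) (θ : Fin n → ℝ) : ℝ≥0∞ :=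
  ∏ i, ENNReal.ofReal (τ⁻¹ * π0 (θ i / τ))

/-- Likelihood of the observation `y` under `N(θ, I_n)`. -/
noncomputable def likelihood {n : ℕ} (y θ : Fin n → ℝ) : ℝ≥0∞ :=
  ∏ i, gaussianPDF (θ i) 1 (y i)

/-- `∫ ∫_A f_θ(y) π(θ | τ) dθ π(dτ)`, the part of the marginal likelihood of `y` that comes from
parameters in `A`, where `P` is the prior law of `τ`. -/
noncomputable def marginal (π0 : ℝ → ℝ) (P : Measure ℝ) {n : ℕ} (y : Fin n → ℝ)
    (A : Set (Fin n → ℝ)) : ℝ≥0∞ :=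
  ∫⁻ τ, ∫⁻ θ in A, likelihood y θ * priorDensity π0 τ θ ∂volume ∂P

/-- Posterior probability of `A` given the data `y` (Bayes' formula). -/
noncomputable def posteriorProb (π0 : ℝ → ℝ) (P : Measure ℝ) {n : ℕ} (y : Fin n → ℝ)
    (A : Set (Fin n → ℝ)) : ℝ≥0∞ :=
  marginal π0 P y A / marginal π0 P y Set.univ

/-- Law `N(θ, I_n)` of the data when `θ` is the true mean vector. -/
noncomputable def dataLaw {n : ℕ} (θ : Fin n → ℝ) : Measure (Fin n → ℝ) :=
  Measure.pi fun i => gaussianReal (θ i) 1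

/-- Expectation, under the true mean `θ'`, of the posterior probability of `A`. -/
noncomputable def expectedPosterior (π0 : ℝ → ℝ) (P : Measure ℝ) {n : ℕ} (θ' : Fin n → ℝ)
    (A : Set (Fin n → ℝ)) : ℝ≥0∞ :=
  ∫⁻ y, posteriorProb π0 P y A ∂(dataLaw θ')

/-- `-log p`, with `-log 0 = ∞`. -/
noncomputable def negLog (p : ℝ≥0∞) : EReal := -ENNReal.log p

/-- `a ≺ b`, that is `a n / b n → 0`. -/
def AsympBelow (a : ℕ → EReal) (b : ℕ → ℝ) : Prop :=
  Tendsto (fun n => a n / (b n : EReal)) atTop (𝓝 0)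

/-- `a ≻ b`, that is `a n / b n → ∞`. -/
def AsympAbove (a : ℕ → EReal) (b : ℕ → ℝ) : Prop :=
  Tendsto (fun n => a n / (b n : EReal)) atTop (𝓝 ⊤)

/-- Constant of the Euclidean contraction rate. -/
noncomputable def rateConstTwo (ω : ℝ) : ℝ := √(2 + ω) + √ω

/-- Constant of the `ℓ¹` contraction rate. -/
noncomputable def rateConstOne (ω : ℝ) : ℝ := √(2 + ω) + √(ω ^ 2 / 5) + √(ω / 5)

end SparseMeans

/-! Let S be the support of the true mean, N its complement, ℓ = log(n/s), L = √(log n), Λ = sL² and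
t = (s/n)^(α/(α-1)). Given τ, the posterior makes the coordinates independent, so everything reduces
to one-dimensional integrals, bounded uniformly over τ below t; larger τ is shown to have negligible
posterior mass. If the noise on S satisfies ∑_S (y_i - θ*_i)² ≤ (ω/5)Λ, a parameter outside either
ball has ∑_S (θ_i - y_i)² ≥ (2+ω)Λ or ∑_N (L|θ_i| + θ_i²) ≥ (ω/5)Λ (`norm_two_lt`, `norm_one_lt`).
The same statistic on N serves both norms.

Signals. For τ ≤ 1, the numerator and the denominator of a posterior exponential moment both decay
like (1+|y|)^(-α). Hence for l < 1 the moment of exp(l(θ-y)²/2) is at most Qτ^(-(α-1)) for every y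
(`exists_lintegral_exp_sq_le`), which is why the size of θ* plays no role. The lower limit of the
support of τ turns this into Q n^(max c 0), and Chernoff's bound leaves (Q n^(-δ))^s with δ > 0
because c < 1 + ω/2.

Nulls. For τ < t the unnormalised moment of L|θ| + θ² is O(Lτ^γ(1+|y|)), while the evidence is at
least half the N(0,1) density. Since γα/(α-1) > 1, averaging over y ~ N(0,1) gives o(L² s/n) per
coordinate, hence o(Λ) over N, and Markov's inequality suffices. Where |y| exceeds a multiple of √ℓ,
a crude bound and the Gaussian tail are used (`exists_null_bound`).

Large τ. On S the evidence for τ ≥ t and for τ in the interval charged by the first prior condition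
are compared with the same profile (1+|y|)^(-α), which cancels. On N the evidence is compared with
the null density, and the resulting likelihood ratios have mean one. So the expected posterior mass
of τ ≥ t is about π_n(τ ≥ t) times exp(O(sℓ)), which the second prior condition kills. Polynomial
growth of the weights in τ is cut off at a power of n/s; beyond it the evidence on N is itself
O(τ^(-β)) per coordinate, thanks to the bound on the pole of the prior density
(`exists_tail_evidence_le`). -/

namespace SparseMeans

/-! ### Product, scaling and Gaussian integrals. -/

/-- Tonelli's theorem for products of functions of one coordinate each. -/
lemma lintegral_pi_prod {n : ℕ} (μ : Fin n → Measure ℝ) [∀ i, SigmaFinite (μ i)]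
    (f : Fin n → ℝ → ℝ≥0∞) (hf : ∀ i, Measurable (f i)) :
    ∫⁻ x, ∏ i, f i (x i) ∂(Measure.pi μ) = ∏ i, ∫⁻ x, f i x ∂(μ i) := by
  induction n with
  | zero => simp
  | succ n ih =>
    have hm : Measurable fun x : Fin n → ℝ => ∏ i : Fin n, f i.succ (x i) :=
      Finset.measurable_prod _ fun i _ => (hf _).comp (measurable_pi_apply i)
    have e := (measurePreserving_piFinSuccAbove μ 0).symm
    rw [← e.lintegral_comp_emb (MeasurableEquiv.measurableEmbedding _)]
    simp_rw [MeasurableEquiv.piFinSuccAbove_symm_apply, Fin.insertNthEquiv,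
      Fin.prod_univ_succ, Fin.insertNth_zero, Equiv.coe_fn_mk, Fin.cons_succ, Fin.cons_zero,
      Fin.zero_succAbove, cast_eq]
    rw [lintegral_prod_mul (hf 0).aemeasurable hm.aemeasurable, ih (fun i => μ i.succ) _
      fun i => hf _]

lemma lintegral_inv_mul_comp_div {f : ℝ → ℝ} (hf : Measurable f) {τ : ℝ} (hτ : 0 < τ) :
    ∫⁻ θ, ENNReal.ofReal (τ⁻¹ * f (θ / τ)) = ∫⁻ x, ENNReal.ofReal (f x) := by
  have hτ' : τ⁻¹ ≠ 0 := by positivity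
  have hm : Measurable fun x => ENNReal.ofReal (f x) := by fun_prop
  have h2 : ∫⁻ x, ENNReal.ofReal (f x) ∂(Measure.map (τ⁻¹ * ·) volume) =
      ∫⁻ θ, ENNReal.ofReal (f (τ⁻¹ * θ)) := lintegral_map hm (by fun_prop)
  rw [Real.map_volume_mul_left hτ', lintegral_smul_measure] at h2
  simp_rw [ENNReal.ofReal_mul (inv_nonneg.2 hτ.le), div_eq_inv_mul]
  rw [lintegral_const_mul' _ _ ENNReal.ofReal_ne_top, ← h2, inv_inv, abs_of_pos hτ, smul_eq_mul,
    ← mul_assoc, ← ENNReal.ofReal_mul (by positivity), inv_mul_cancel₀ hτ.ne', ENNReal.ofReal_one,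
    one_mul]

lemma gaussianPDFReal_one (θ y : ℝ) :
    gaussianPDFReal θ 1 y = (√(2 * Real.pi))⁻¹ * Real.exp (-(y - θ) ^ 2 / 2) := by
  simp [gaussianPDFReal]

lemma inv_sqrt_two_pi_le_one : (√(2 * Real.pi))⁻¹ ≤ 1 := by
  apply inv_le_one_of_one_le₀
  rw [Real.one_le_sqrt]
  nlinarith [Real.pi_gt_three]

lemma gaussianPDFReal_le_exp (θ y : ℝ) :
    gaussianPDFReal θ 1 y ≤ Real.exp (-(y - θ) ^ 2 / 2) := by
  rw [gaussianPDFReal_one]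
  exact mul_le_of_le_one_left (Real.exp_pos _).le inv_sqrt_two_pi_le_one

lemma gaussianPDF_le_one (θ y : ℝ) : gaussianPDF θ 1 y ≤ 1 := by
  rw [gaussianPDF, ← ENNReal.ofReal_one]
  refine ENNReal.ofReal_le_ofReal ((gaussianPDFReal_le_exp θ y).trans ?_)
  rw [Real.exp_le_one_iff]
  nlinarith [sq_nonneg (y - θ)]

lemma gaussianPDF_comm (θ y : ℝ) : gaussianPDF θ 1 y = gaussianPDF y 1 θ := by
  rw [gaussianPDF, gaussianPDF, gaussianPDFReal_one, gaussianPDFReal_one, ← neg_sub y θ, neg_sq]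

@[fun_prop]
lemma measurable_gaussianPDF_comp {α : Type*} [MeasurableSpace α] {f g : α → ℝ}
    (hf : Measurable f) (hg : Measurable g) : Measurable fun a => gaussianPDF (f a) 1 (g a) := by
  simp_rw [gaussianPDF, gaussianPDFReal_one]
  fun_prop

lemma lintegral_gaussianPDF_mean (y : ℝ) : ∫⁻ θ, gaussianPDF θ 1 y = 1 := by
  simp_rw [gaussianPDF_comm _ y]
  exact lintegral_gaussianPDF_eq_one y one_ne_zero

lemma lintegral_comp_abs (f : ℝ → ℝ≥0∞) :
    ∫⁻ x, f |x| = 2 * ∫⁻ x in Set.Ioi 0, f x := by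
  have h1 : ∫⁻ x in Set.Ioi 0, f |x| = ∫⁻ x in Set.Ioi 0, f x :=
    setLIntegral_congr_fun measurableSet_Ioi fun x hx => by rw [abs_of_pos hx]
  have h2 : ∫⁻ x in Set.Iic 0, f |x| = ∫⁻ x in Set.Ioi 0, f x := by
    rw [← h1, setLIntegral_congr Iio_ae_eq_Iic.symm, ← lintegral_indicator measurableSet_Iio,
      ← lintegral_indicator measurableSet_Ioi, ← lintegral_neg_eq_self]
    refine lintegral_congr fun x => ?_
    simp only [Set.indicator, Set.mem_Iio, Set.mem_Ioi, Left.neg_neg_iff, abs_neg]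
  rw [← lintegral_add_compl _ measurableSet_Ioi, Set.compl_Ioi, h1, h2, two_mul]

/-- `∫ |θ|^(-γ) φ(y - θ) dθ` is bounded in `y`. -/
lemma exists_lintegral_rpow_neg_gaussian_le {γ : ℝ} (hγ0 : 0 < γ) (hγ : γ < 1) :
    ∃ C : ℝ, 0 < C ∧ ∀ y : ℝ,
      ∫⁻ θ, ENNReal.ofReal (|θ| ^ (-γ)) * gaussianPDF θ 1 y ≤ ENNReal.ofReal C := by
  set J : ℝ≥0∞ := ∫⁻ θ : ℝ, (Set.Ioc 0 1).indicator (fun t => ENNReal.ofReal (t ^ (-γ))) |θ|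
  have hJ : J ≠ ⊤ := by
    simp only [J]
    rw [lintegral_comp_abs, ← lintegral_indicator measurableSet_Ioi]
    refine ENNReal.mul_ne_top (by simp) ?_
    have hi : IntegrableOn (fun t : ℝ => t ^ (-γ)) (Set.Ioc 0 1) :=
      (intervalIntegrable_iff_integrableOn_Ioc_of_le zero_le_one).1
        (intervalIntegral.intervalIntegrable_rpow' (by linarith))
    have := hi.hasFiniteIntegral
    rw [hasFiniteIntegral_iff_norm] at this
    refine ne_top_of_le_ne_top this.ne ?_
    rw [← lintegral_indicator measurableSet_Ioc]
    refine lintegral_mono fun t => ?_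
    simp only [Set.indicator]
    split_ifs <;> first | positivity | skip
    exact ENNReal.ofReal_le_ofReal (Real.le_norm_self _)
  refine ⟨1 + J.toReal, by positivity, fun y => ?_⟩
  rw [ENNReal.ofReal_add (by positivity) (by positivity), ENNReal.ofReal_toReal hJ,
    ENNReal.ofReal_one]
  calc ∫⁻ θ, ENNReal.ofReal (|θ| ^ (-γ)) * gaussianPDF θ 1 y
      ≤ ∫⁻ θ, (gaussianPDF θ 1 y +
        (Set.Ioc 0 1).indicator (fun t => ENNReal.ofReal (t ^ (-γ))) |θ|) := by
        refine lintegral_mono_ae ?_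
        filter_upwards [Measure.ae_ne volume (0 : ℝ)] with θ hθ
        have hθ' : 0 < |θ| := abs_pos.2 hθ
        by_cases h : |θ| ≤ 1
        · rw [Set.indicator_of_mem (show |θ| ∈ Set.Ioc 0 1 from ⟨hθ', h⟩)]
          exact (mul_le_of_le_one_right' (gaussianPDF_le_one _ _)).trans le_add_self
        · refine (mul_le_of_le_one_left' ?_).trans le_self_add
          rw [← ENNReal.ofReal_one]
          exact ENNReal.ofReal_le_ofReal
            (Real.rpow_le_one_of_one_le_of_nonpos (not_le.1 h).le (by linarith))
    _ = 1 + J := by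
        rw [lintegral_add_left (by fun_prop), lintegral_gaussianPDF_mean]

/-- Follows from 1 + x ≤ exp x and completing the square in ax ≤ a²/(4κ) + κx². This is how
polynomial factors are absorbed into Gaussian ones throughout. -/
lemma one_add_rpow_le_exp {a κ x : ℝ} (ha : 0 ≤ a) (hκ : 0 < κ) (hx : 0 ≤ x) :
    (1 + x) ^ a ≤ Real.exp (a ^ 2 / (4 * κ)) * Real.exp (κ * x ^ 2) := by
  calc (1 + x) ^ a ≤ (Real.exp x) ^ a :=
        Real.rpow_le_rpow (by positivity) (by linarith [Real.add_one_le_exp x]) ha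
    _ = Real.exp (x * a) := by rw [← Real.exp_mul]
    _ ≤ _ := by
        rw [← Real.exp_add, Real.exp_le_exp]
        have : a ^ 2 / (4 * κ) + κ * x ^ 2 - x * a = (2 * κ * x - a) ^ 2 / (4 * κ) := by
          field_simp; ring
        have h2 : 0 ≤ (2 * κ * x - a) ^ 2 / (4 * κ) := by positivity
        linarith

lemma lintegral_exp_neg_mul_sq_le {κ : ℝ} (hκ : 0 < κ) (y : ℝ) :
    ∫⁻ θ, ENNReal.ofReal (Real.exp (-κ * (y - θ) ^ 2)) = ENNReal.ofReal (√(Real.pi / κ)) := by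
  rw [lintegral_sub_left_eq_self (fun θ => ENNReal.ofReal (Real.exp (-κ * θ ^ 2))),
    ← ofReal_integral_eq_lintegral_ofReal (integrable_exp_neg_mul_sq hκ)
      (ae_of_all _ fun _ => (Real.exp_pos _).le), integral_gaussian]

/-! ### Pointwise power bounds for the prior density. -/

section Density

variable {π0 : ℝ → ℝ} {α : ℝ}

/-- On 1 ≤ |x| ≤ M monotonicity traps the density between its values at ±(M+1) and at ±1, so the
tail threshold can be moved to 1 by changing the constants. -/
lemma IsPolyTailDensity.exists_tail_bounds (h : IsPolyTailDensity π0 α) :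
    ∃ c C : ℝ, 0 < c ∧ 0 < C ∧
      ∀ x : ℝ, 1 ≤ |x| → c * |x| ^ (-α) ≤ π0 x ∧ π0 x ≤ C * |x| ^ (-α) := by
  obtain ⟨M, C₁, C₂, hM, hC₁, hC, ht⟩ := h.tail
  have hα := h.one_lt_order
  have hlow : ∀ x : ℝ, 1 ≤ |x| → |x| ≤ M → C₁ * (M + 1) ^ (-α) ≤ π0 x := by
    intro x h1 h2
    rcases le_total 0 x with hx | hx
    · rw [abs_of_nonneg hx] at h1 h2
      have := (ht (M + 1) (by rw [abs_of_pos (by linarith)]; linarith)).1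
      rw [abs_of_pos (show 0 < M + 1 by linarith)] at this
      exact this.trans (h.strictAntiOn_pos.antitoneOn (Set.mem_Ioi.2 (by linarith))
        (Set.mem_Ioi.2 (by linarith)) (by linarith))
    · rw [abs_of_nonpos hx] at h1 h2
      have := (ht (-(M + 1)) (by rw [abs_neg, abs_of_pos (by linarith)]; linarith)).1
      rw [abs_neg, abs_of_pos (show 0 < M + 1 by linarith)] at this
      exact this.trans (h.monotoneOn_neg (Set.mem_Iio.2 (by linarith))
        (Set.mem_Iio.2 (by linarith)) (by linarith))
  have hupp : ∀ x : ℝ, 1 ≤ |x| → π0 x ≤ π0 1 + π0 (-1) := by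
    intro x h1
    rcases le_total 0 x with hx | hx
    · rw [abs_of_nonneg hx] at h1
      have := h.strictAntiOn_pos.antitoneOn (Set.mem_Ioi.2 one_pos)
        (Set.mem_Ioi.2 (by linarith)) h1
      linarith [h.nonneg (-1)]
    · rw [abs_of_nonpos hx] at h1
      have := h.monotoneOn_neg (Set.mem_Iio.2 (show x < 0 by linarith))
        (Set.mem_Iio.2 (show (-1 : ℝ) < 0 by linarith)) (by linarith)
      linarith [h.nonneg 1]
  refine ⟨min C₁ (C₁ * (M + 1) ^ (-α)), max C₂ ((π0 1 + π0 (-1)) * M ^ α), by positivity,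
    lt_max_of_lt_left (hC₁.trans hC), fun x hx => ?_⟩
  have hx0 : 0 < |x| := by linarith
  rcases lt_or_ge M |x| with hMx | hMx
  · obtain ⟨h1, h2⟩ := ht x hMx
    exact ⟨(mul_le_mul_of_nonneg_right (min_le_left _ _) (by positivity)).trans h1,
      h2.trans (mul_le_mul_of_nonneg_right (le_max_left _ _) (by positivity))⟩
  · constructor
    · refine le_trans ?_ (hlow x hx hMx)
      calc _ ≤ C₁ * (M + 1) ^ (-α) * |x| ^ (-α) :=
            mul_le_mul_of_nonneg_right (min_le_right _ _) (by positivity)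
        _ ≤ _ := mul_le_of_le_one_right (by positivity)
            (Real.rpow_le_one_of_one_le_of_nonpos hx (by linarith))
    · refine (hupp x hx).trans ?_
      have h0 : 0 ≤ π0 1 + π0 (-1) := add_nonneg (h.nonneg _) (h.nonneg _)
      calc π0 1 + π0 (-1) ≤ (π0 1 + π0 (-1)) * (M ^ α * |x| ^ (-α)) := by
            refine le_mul_of_one_le_right h0 ?_
            rw [Real.rpow_neg hx0.le, ← div_eq_mul_inv, one_le_div (by positivity)]
            exact Real.rpow_le_rpow hx0.le hMx (by linarith)
        _ ≤ _ := by
            rw [← mul_assoc]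
            exact mul_le_mul_of_nonneg_right (le_max_right _ _) (by positivity)

/-- The power |x|^(-a) dominates |x|^(β-1) near 0 when a ≥ 1-β and |x|^(-α) at infinity when a ≤ α.
Three exponents are used later: a = α for tails in y, a = 1-β for decay as τ grows, and a = 1+γ for
moments that vanish with τ. -/
lemma IsPolyTailDensity.exists_rpow_bound (h : IsPolyTailDensity π0 α)
    (hpole : ∃ β K : ℝ, 0 < β ∧ ∀ x : ℝ, 0 < |x| → |x| ≤ 1 → π0 x ≤ K * |x| ^ (β - 1)) :
    ∃ β C : ℝ, 0 < β ∧ β < 1 ∧ 0 < C ∧ ∀ a : ℝ, 1 - β ≤ a → a ≤ α → ∀ τ : ℝ, 0 < τ →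
      ∀ θ : ℝ, θ ≠ 0 → τ⁻¹ * π0 (θ / τ) ≤ C * τ ^ (a - 1) * |θ| ^ (-a) := by
  obtain ⟨β, K, hβ, hK⟩ := hpole
  obtain ⟨c, C, -, hC, ht⟩ := h.exists_tail_bounds
  -- Capping β at 1/2 keeps 1-β in (0,1), so |θ|^(-(1-β)) is an integrable singularity that decays
  -- at infinity.
  refine ⟨min β (1 / 2), max K C, by positivity, (min_le_right _ _).trans_lt (by norm_num),
    lt_max_of_lt_right hC, fun a ha1 ha2 τ hτ θ hθ => ?_⟩
  have key : ∀ x : ℝ, x ≠ 0 → π0 x ≤ max K C * |x| ^ (-a) := by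
    intro x hx
    have hx0 : 0 < |x| := abs_pos.2 hx
    rcases le_total |x| 1 with h1 | h1
    · have hK0 : 0 ≤ K := by
        have := (h.nonneg x).trans (hK x hx0 h1)
        exact nonneg_of_mul_nonneg_left this (by positivity)
      refine (hK x hx0 h1).trans (mul_le_mul (le_max_left _ _) ?_ (by positivity) (by positivity))
      exact Real.rpow_le_rpow_of_exponent_ge hx0 h1 (by linarith [min_le_left β (1 / 2)])
    · refine (ht x h1).2.trans
        (mul_le_mul (le_max_right _ _) ?_ (by positivity) (by positivity))
      exact Real.rpow_le_rpow_of_exponent_le h1 (by linarith)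
  calc τ⁻¹ * π0 (θ / τ) ≤ τ⁻¹ * (max K C * |θ / τ| ^ (-a)) :=
        mul_le_mul_of_nonneg_left (key _ (by positivity)) (by positivity)
    _ = _ := by
        rw [abs_div, abs_of_pos hτ, Real.div_rpow (abs_nonneg _) hτ.le, Real.rpow_sub hτ,
          Real.rpow_neg hτ.le, Real.rpow_one]
        field_simp

end Density

/-! ### Bounds for one coordinate given τ. -/

/-- Joint density of one observation `y` and its mean `θ`, given `τ`. -/
noncomputable def coordKernel (π0 : ℝ → ℝ) (τ y θ : ℝ) : ℝ≥0∞ :=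
  gaussianPDF θ 1 y * ENNReal.ofReal (τ⁻¹ * π0 (θ / τ))

/-- Marginal density of one observation `y`, given `τ`. -/
noncomputable def coordMarginal (π0 : ℝ → ℝ) (τ y : ℝ) : ℝ≥0∞ :=
  ∫⁻ θ, coordKernel π0 τ y θ

variable {π0 : ℝ → ℝ} {α : ℝ}

lemma measurable_coordKernel_uncurry (h : Measurable π0) :
    Measurable fun p : (ℝ × ℝ) × ℝ => coordKernel π0 p.1.1 p.1.2 p.2 := by
  unfold coordKernel
  fun_prop

@[fun_prop]
lemma measurable_coordKernel_comp {β : Type*} [MeasurableSpace β] (h : Measurable π0)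
    {f g k : β → ℝ} (hf : Measurable f) (hg : Measurable g) (hk : Measurable k) :
    Measurable fun a => coordKernel π0 (f a) (g a) (k a) := by
  unfold coordKernel
  fun_prop

lemma measurable_coordKernel (h : Measurable π0) (τ y : ℝ) :
    Measurable (coordKernel π0 τ y) := by
  unfold coordKernel
  fun_prop

lemma measurable_coordMarginal_uncurry (h : Measurable π0) :
    Measurable fun p : ℝ × ℝ => coordMarginal π0 p.1 p.2 :=
  (measurable_coordKernel_uncurry h).lintegral_prod_right'

@[fun_prop]
lemma measurable_coordMarginal_comp {β : Type*} [MeasurableSpace β] (h : Measurable π0)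
    {f g : β → ℝ} (hf : Measurable f) (hg : Measurable g) :
    Measurable fun a => coordMarginal π0 (f a) (g a) := by
  have := (measurable_coordMarginal_uncurry h).comp (hf.prodMk hg)
  exact this

lemma IsPolyTailDensity.lintegral_scaled (h : IsPolyTailDensity π0 α) {τ : ℝ} (hτ : 0 < τ) :
    ∫⁻ θ, ENNReal.ofReal (τ⁻¹ * π0 (θ / τ)) = 1 := by
  rw [lintegral_inv_mul_comp_div h.measurable hτ, h.lintegral_eq_one]

lemma IsPolyTailDensity.lintegral_coordMarginal (h : IsPolyTailDensity π0 α) {τ : ℝ}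
    (hτ : 0 < τ) : ∫⁻ y, coordMarginal π0 τ y = 1 := by
  have hm := h.measurable
  unfold coordMarginal
  rw [lintegral_lintegral_swap]
  · simp_rw [coordKernel]
    simp_rw [lintegral_mul_const _ (measurable_gaussianPDF _ _),
      lintegral_gaussianPDF_eq_one _ one_ne_zero, one_mul]
    exact h.lintegral_scaled hτ
  · unfold coordKernel Function.uncurry
    fun_prop

/-- The slab part of the prior bounds the marginal density from below. -/
lemma IsPolyTailDensity.exists_le_coordMarginal (h : IsPolyTailDensity π0 α) :
    ∃ c : ℝ, 0 < c ∧ ∀ τ y : ℝ, 0 < τ → τ ≤ 1 →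
      ENNReal.ofReal (c * τ ^ (α - 1) * (1 + |y|) ^ (-α)) ≤ coordMarginal π0 τ y := by
  obtain ⟨c, C, hc, -, ht⟩ := h.exists_tail_bounds
  have hα := h.one_lt_order
  refine ⟨(√(2 * Real.pi))⁻¹ * Real.exp (-2) * (c * 2 ^ (-α)), by positivity,
    fun τ y hτ hτ1 => ?_⟩
  -- A unit interval on the side of y away from the origin: there |θ| ≥ 1 ≥ τ, so the tail bound
  -- applies to θ/τ, while the likelihood stays above a constant.
  obtain ⟨E, hE, hvol, hEy⟩ : ∃ E : Set ℝ, MeasurableSet E ∧ volume E = 1 ∧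
      ∀ θ ∈ E, 1 ≤ |θ| ∧ |θ| ≤ |y| + 2 ∧ |y - θ| ≤ 2 := by
    rcases le_total 0 y with hy | hy
    · refine ⟨Set.Icc (y + 1) (y + 2), measurableSet_Icc, ?_, fun θ hθ => ?_⟩
      · rw [Real.volume_Icc]; norm_num
      · have := hθ.1; have := hθ.2
        rw [abs_of_nonneg hy, abs_of_nonneg (show 0 ≤ θ by linarith), abs_le]
        exact ⟨by linarith, by linarith, by linarith, by linarith⟩
    · refine ⟨Set.Icc (y - 2) (y - 1), measurableSet_Icc, ?_, fun θ hθ => ?_⟩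
      · rw [Real.volume_Icc]; norm_num
      · have := hθ.1; have := hθ.2
        rw [abs_of_nonpos hy, abs_of_nonpos (show θ ≤ 0 by linarith), abs_le]
        exact ⟨by linarith, by linarith, by linarith, by linarith⟩
  calc _ = ∫⁻ θ in E, ENNReal.ofReal ((√(2 * Real.pi))⁻¹ * Real.exp (-2) * (c * 2 ^ (-α)) *
          τ ^ (α - 1) * (1 + |y|) ^ (-α)) := by
        rw [setLIntegral_const, hvol, mul_one]
    _ ≤ ∫⁻ θ in E, coordKernel π0 τ y θ := by
        refine setLIntegral_mono' hE fun θ hθ => ?_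
        obtain ⟨h1, h2, h3⟩ := hEy θ hθ
        have h0 : 0 < |θ| := by linarith
        rw [coordKernel, gaussianPDF, ← ENNReal.ofReal_mul (gaussianPDFReal_nonneg _ _ _),
          gaussianPDFReal_one]
        apply ENNReal.ofReal_le_ofReal
        have e1 : Real.exp (-2) ≤ Real.exp (-(y - θ) ^ 2 / 2) := by
          rw [Real.exp_le_exp, ← sq_abs]
          nlinarith [abs_nonneg (y - θ)]
        have e2 : c * 2 ^ (-α) * τ ^ (α - 1) * (1 + |y|) ^ (-α) ≤ τ⁻¹ * π0 (θ / τ) := by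
          have := (ht (θ / τ) (by
            rw [abs_div, abs_of_pos hτ, le_div_iff₀ hτ]; linarith)).1
          refine le_trans ?_ (mul_le_mul_of_nonneg_left this (by positivity))
          have e3 : (2 * (1 + |y|)) ^ (-α) ≤ |θ| ^ (-α) :=
            Real.rpow_le_rpow_of_nonpos h0 (by linarith [abs_nonneg y]) (by linarith)
          rw [Real.mul_rpow (by positivity) (by positivity)] at e3
          calc _ = c * τ ^ (α - 1) * (2 ^ (-α) * (1 + |y|) ^ (-α)) := by ring
            _ ≤ c * τ ^ (α - 1) * |θ| ^ (-α) := by gcongr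
            _ = _ := by
              rw [abs_div, abs_of_pos hτ, Real.div_rpow (abs_nonneg _) hτ.le, Real.rpow_sub hτ,
                Real.rpow_neg hτ.le, Real.rpow_one]
              field_simp
        calc _ = (√(2 * Real.pi))⁻¹ * Real.exp (-2) *
              (c * 2 ^ (-α) * τ ^ (α - 1) * (1 + |y|) ^ (-α)) := by ring
          _ ≤ _ := by gcongr
    _ ≤ coordMarginal π0 τ y := setLIntegral_le_lintegral _ _

/-- Gaussian-type smoothing of the scaled prior density has polynomial tails. -/
lemma IsPolyTailDensity.exists_lintegral_exp_mul_le (h : IsPolyTailDensity π0 α)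
    (hpole : ∃ β K : ℝ, 0 < β ∧ ∀ x : ℝ, 0 < |x| → |x| ≤ 1 → π0 x ≤ K * |x| ^ (β - 1))
    {κ : ℝ} (hκ : 0 < κ) :
    ∃ C : ℝ, 0 < C ∧ ∀ τ y : ℝ, 0 < τ →
      ∫⁻ θ, ENNReal.ofReal (Real.exp (-κ * (y - θ) ^ 2)) * ENNReal.ofReal (τ⁻¹ * π0 (θ / τ)) ≤
        ENNReal.ofReal (C * max 1 τ ^ α * (1 + |y|) ^ (-α)) := by
  obtain ⟨β, C, hβ, hβ1, hC, hb⟩ := h.exists_rpow_bound hpole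
  have hα := h.one_lt_order
  have hm := h.measurable
  set A : ℝ := Real.exp (α ^ 2 / (4 * (κ / 4))) with hA
  set B : ℝ := C * 4 ^ α * √(Real.pi / κ) with hB
  refine ⟨3 ^ α + A + B, by positivity, fun τ y hτ => ?_⟩
  set μ := max 1 τ with hμ
  have hμ1 : 1 ≤ μ := le_max_left _ _
  have hμτ : τ ≤ μ := le_max_right _ _
  have hexp : ∀ θ : ℝ, ENNReal.ofReal (Real.exp (-κ * (y - θ) ^ 2)) ≤ 1 := fun θ => by
    rw [← ENNReal.ofReal_one]
    refine ENNReal.ofReal_le_ofReal (Real.exp_le_one_iff.2 ?_)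
    nlinarith [sq_nonneg (y - θ)]
  have hpos : 0 < 1 + |y| := by positivity
  -- For |y| ≤ 2μ the total prior mass 1 is already below the target. Otherwise split at |θ| =
  -- |y|/2: below it the exponential is tiny, above it the prior density is O(τ^(α-1)|y|^(-α)).
  rcases le_or_gt |y| (2 * μ) with hy | hy
  · calc _ ≤ ∫⁻ θ, ENNReal.ofReal (τ⁻¹ * π0 (θ / τ)) :=
          lintegral_mono fun θ => mul_le_of_le_one_left' (hexp θ)
      _ = ENNReal.ofReal 1 := by rw [h.lintegral_scaled hτ, ENNReal.ofReal_one]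
      _ ≤ _ := by
        apply ENNReal.ofReal_le_ofReal
        calc (1 : ℝ) ≤ (3 * μ) ^ α * (1 + |y|) ^ (-α) := by
              rw [Real.rpow_neg hpos.le, ← div_eq_mul_inv, one_le_div (by positivity)]
              exact Real.rpow_le_rpow hpos.le (by linarith) (by linarith)
          _ = 3 ^ α * μ ^ α * (1 + |y|) ^ (-α) := by
              rw [Real.mul_rpow (by positivity) (by positivity)]
          _ ≤ _ := by
              gcongr
              have : 0 < A := Real.exp_pos _
              have : 0 < B := by positivity
              linarith
  · have hy2 : 2 < |y| := by linarith
    have hpt : ∀ θ : ℝ, ENNReal.ofReal (Real.exp (-κ * (y - θ) ^ 2)) *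
        ENNReal.ofReal (τ⁻¹ * π0 (θ / τ)) ≤
        ENNReal.ofReal (Real.exp (-(κ / 4) * |y| ^ 2)) * ENNReal.ofReal (τ⁻¹ * π0 (θ / τ)) +
        ENNReal.ofReal (C * τ ^ (α - 1) * (|y| / 2) ^ (-α)) *
          ENNReal.ofReal (Real.exp (-κ * (y - θ) ^ 2)) := by
      intro θ
      rcases le_or_gt |θ| (|y| / 2) with hθ | hθ
      · refine le_trans ?_ le_self_add
        gcongr ENNReal.ofReal (Real.exp ?_) * _
        have : |y| / 2 ≤ |y - θ| := by linarith [abs_sub_abs_le_abs_sub y θ]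
        have h2 : (|y| / 2) ^ 2 ≤ (y - θ) ^ 2 := by
          rw [← sq_abs (y - θ)]
          exact pow_le_pow_left₀ (by positivity) this 2
        nlinarith
      · refine le_trans ?_ le_add_self
        rw [mul_comm]
        gcongr ENNReal.ofReal ?_ * _
        have hθ0 : θ ≠ 0 := by
          rintro rfl; simp at hθ; linarith [abs_nonneg y]
        refine (hb α (by linarith) le_rfl τ hτ θ hθ0).trans ?_
        refine mul_le_mul_of_nonneg_left ?_ (by positivity)
        exact Real.rpow_le_rpow_of_nonpos (by positivity) hθ.le (by linarith)
    refine (lintegral_mono hpt).trans ?_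
    rw [lintegral_add_left (by fun_prop), lintegral_const_mul' _ _ ENNReal.ofReal_ne_top,
      lintegral_const_mul' _ _ ENNReal.ofReal_ne_top, h.lintegral_scaled hτ, mul_one,
      lintegral_exp_neg_mul_sq_le hκ, ← ENNReal.ofReal_mul (by positivity),
      ← ENNReal.ofReal_add (by positivity) (by positivity)]
    apply ENNReal.ofReal_le_ofReal
    have hμα : 1 ≤ μ ^ α := Real.one_le_rpow hμ1 (by linarith)
    have e1 : Real.exp (-(κ / 4) * |y| ^ 2) ≤ A * μ ^ α * (1 + |y|) ^ (-α) := by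
      have := one_add_rpow_le_exp (a := α) (κ := κ / 4) (by linarith) (by positivity) (abs_nonneg y)
      rw [← hA] at this
      have h3 : Real.exp (-(κ / 4) * |y| ^ 2) ≤ A * (1 + |y|) ^ (-α) := by
        rw [neg_mul, Real.exp_neg, Real.rpow_neg hpos.le, ← div_eq_mul_inv, le_div_iff₀ (by positivity),
          inv_mul_le_iff₀ (Real.exp_pos _), mul_comm]
        exact this
      refine h3.trans ?_
      have : A * (1 + |y|) ^ (-α) ≤ A * (1 + |y|) ^ (-α) * μ ^ α :=
        le_mul_of_one_le_right (by positivity) hμα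
      linarith
    have e2 : C * τ ^ (α - 1) * (|y| / 2) ^ (-α) * √(Real.pi / κ) ≤
        B * μ ^ α * (1 + |y|) ^ (-α) := by
      have h1 : τ ^ (α - 1) ≤ μ ^ α :=
        (Real.rpow_le_rpow hτ.le hμτ (by linarith)).trans
          (Real.rpow_le_rpow_of_exponent_le hμ1 (by linarith))
      have h2 : (|y| / 2) ^ (-α) ≤ 4 ^ α * (1 + |y|) ^ (-α) := by
        have : (|y| / 2) ^ (-α) ≤ ((1 + |y|) / 4) ^ (-α) :=
          Real.rpow_le_rpow_of_nonpos (by positivity) (by linarith) (by linarith)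
        refine this.trans (le_of_eq ?_)
        rw [Real.div_rpow hpos.le (by norm_num), Real.rpow_neg (by norm_num : (0:ℝ) ≤ 4)]
        field_simp
      calc _ ≤ C * μ ^ α * (4 ^ α * (1 + |y|) ^ (-α)) * √(Real.pi / κ) := by gcongr
        _ = _ := by rw [hB]; ring
    have e3 : 0 ≤ 3 ^ α * μ ^ α * (1 + |y|) ^ (-α) := by positivity
    linarith

/-- For large `τ` the marginal density is uniformly small. -/
lemma IsPolyTailDensity.exists_coordMarginal_le (h : IsPolyTailDensity π0 α)
    (hpole : ∃ β K : ℝ, 0 < β ∧ ∀ x : ℝ, 0 < |x| → |x| ≤ 1 → π0 x ≤ K * |x| ^ (β - 1)) :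
    ∃ β C : ℝ, 0 < β ∧ 0 < C ∧ ∀ τ y : ℝ, 0 < τ →
      coordMarginal π0 τ y ≤ ENNReal.ofReal (C * τ ^ (-β)) := by
  obtain ⟨β, C, hβ, hβ1, hC, hb⟩ := h.exists_rpow_bound hpole
  have hα := h.one_lt_order
  obtain ⟨C', hC', hg⟩ := exists_lintegral_rpow_neg_gaussian_le (γ := 1 - β) (by linarith)
    (by linarith)
  refine ⟨β, C * C', hβ, by positivity, fun τ y hτ => ?_⟩
  calc coordMarginal π0 τ y ≤ ∫⁻ θ, ENNReal.ofReal (C * τ ^ (-β)) *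
        (ENNReal.ofReal (|θ| ^ (-(1 - β))) * gaussianPDF θ 1 y) := by
        refine lintegral_mono_ae ?_
        filter_upwards [Measure.ae_ne volume (0 : ℝ)] with θ hθ
        rw [coordKernel, mul_comm, ← mul_assoc, ← ENNReal.ofReal_mul (by positivity)]
        gcongr ENNReal.ofReal ?_ * _
        have := hb (1 - β) le_rfl (by linarith) τ hτ θ hθ
        rwa [show 1 - β - 1 = -β by ring] at this
    _ ≤ ENNReal.ofReal (C * τ ^ (-β)) * ENNReal.ofReal C' := by
        rw [lintegral_const_mul' _ _ ENNReal.ofReal_ne_top]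
        exact mul_le_mul_right (hg y) _
    _ = _ := by
        rw [← ENNReal.ofReal_mul (by positivity)]
        ring_nf

/-- Posterior exponential moment of the squared residual of one coordinate. -/
lemma IsPolyTailDensity.exists_lintegral_exp_sq_le (h : IsPolyTailDensity π0 α)
    (hpole : ∃ β K : ℝ, 0 < β ∧ ∀ x : ℝ, 0 < |x| → |x| ≤ 1 → π0 x ≤ K * |x| ^ (β - 1))
    {l : ℝ} (hl : l < 1) :
    ∃ Q : ℝ, 1 ≤ Q ∧ ∀ τ y : ℝ, 0 < τ → τ ≤ 1 →
      ∫⁻ θ, ENNReal.ofReal (Real.exp (l / 2 * (θ - y) ^ 2)) * coordKernel π0 τ y θ ≤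
        ENNReal.ofReal (Q * τ ^ (-(α - 1))) * coordMarginal π0 τ y := by
  obtain ⟨C, hC, hu⟩ := h.exists_lintegral_exp_mul_le hpole (κ := (1 - l) / 2) (by linarith)
  obtain ⟨c, hc, hlow⟩ := h.exists_le_coordMarginal
  -- Tilting leaves a Gaussian factor of rate (1-l)/2, so upper bound and slab lower bound have the
  -- same profile in y and their quotient depends on τ alone.
  refine ⟨max 1 (C / c), le_max_left _ _, fun τ y hτ hτ1 => ?_⟩
  calc _ ≤ ∫⁻ θ, ENNReal.ofReal (Real.exp (-((1 - l) / 2) * (y - θ) ^ 2)) *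
        ENNReal.ofReal (τ⁻¹ * π0 (θ / τ)) := by
        refine lintegral_mono fun θ => ?_
        rw [coordKernel, ← mul_assoc, gaussianPDF, ← ENNReal.ofReal_mul (Real.exp_pos _).le]
        gcongr ENNReal.ofReal ?_ * _
        refine (mul_le_mul_of_nonneg_left (gaussianPDFReal_le_exp θ y)
          (Real.exp_pos _).le).trans (le_of_eq ?_)
        rw [← Real.exp_add]
        congr 1
        ring
    _ ≤ ENNReal.ofReal (C * max 1 τ ^ α * (1 + |y|) ^ (-α)) := hu τ y hτ
    _ = ENNReal.ofReal (C / c * τ ^ (-(α - 1))) *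
          ENNReal.ofReal (c * τ ^ (α - 1) * (1 + |y|) ^ (-α)) := by
        rw [← ENNReal.ofReal_mul (by positivity), max_eq_left hτ1, Real.one_rpow,
          Real.rpow_neg hτ.le]
        congr 1
        field_simp
    _ ≤ _ := by
        gcongr
        · exact le_max_right _ _
        · exact hlow τ y hτ hτ1

/-- Moments of order γ < α - 1 are finite under the tail of order α, and rescaling by τ multiplies
them by τ^γ. -/
lemma IsPolyTailDensity.exists_lintegral_rpow_mul_scaled (h : IsPolyTailDensity π0 α) {γ : ℝ}
    (hγ0 : 0 < γ) (hγ : γ < α - 1) :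
    ∃ J : ℝ, 0 < J ∧ ∀ τ : ℝ, 0 < τ →
      ∫⁻ θ, ENNReal.ofReal (|θ| ^ γ) * ENNReal.ofReal (τ⁻¹ * π0 (θ / τ)) ≤
        ENNReal.ofReal (J * τ ^ γ) := by
  obtain ⟨c, C, -, hC, ht⟩ := h.exists_tail_bounds
  have hm := h.measurable
  have hfin : ∫⁻ x, ENNReal.ofReal (|x| ^ γ * π0 x) ≠ ⊤ := by
    have hi : IntegrableOn (fun t : ℝ => C * t ^ (γ - α)) (Set.Ioi 1) :=
      (integrableOn_Ioi_rpow_of_lt (by linarith) one_pos).const_mul C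
    have hi' := hi.hasFiniteIntegral
    rw [hasFiniteIntegral_iff_norm] at hi'
    have hle : ∀ x : ℝ, ENNReal.ofReal (|x| ^ γ * π0 x) ≤ ENNReal.ofReal (π0 x) +
        (Set.Ioi 1).indicator (fun t => ENNReal.ofReal (C * t ^ (γ - α))) |x| := by
      intro x
      rcases le_or_gt |x| 1 with hx | hx
      · refine le_trans (ENNReal.ofReal_le_ofReal ?_) le_self_add
        exact mul_le_of_le_one_left (h.nonneg x)
          (Real.rpow_le_one (abs_nonneg _) hx hγ0.le)
      · rw [Set.indicator_of_mem (Set.mem_Ioi.2 hx)]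
        refine le_trans (ENNReal.ofReal_le_ofReal ?_) le_add_self
        have hx0 : 0 < |x| := by linarith
        calc |x| ^ γ * π0 x ≤ |x| ^ γ * (C * |x| ^ (-α)) :=
              mul_le_mul_of_nonneg_left (ht x hx.le).2 (by positivity)
          _ = _ := by
              rw [sub_eq_add_neg, Real.rpow_add hx0]; ring
    refine ne_top_of_le_ne_top ?_ (lintegral_mono hle)
    rw [lintegral_add_left (by fun_prop), h.lintegral_eq_one,
      lintegral_comp_abs (fun t => (Set.Ioi 1).indicator (fun t => ENNReal.ofReal (C * t ^ (γ - α))) t)]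
    refine ENNReal.add_ne_top.2 ⟨by simp, ENNReal.mul_ne_top (by simp) ?_⟩
    refine ne_top_of_le_ne_top hi'.ne ?_
    refine (setLIntegral_le_lintegral _ _).trans ?_
    rw [lintegral_indicator measurableSet_Ioi]
    exact lintegral_mono fun t => ENNReal.ofReal_le_ofReal (Real.le_norm_self _)
  refine ⟨(∫⁻ x, ENNReal.ofReal (|x| ^ γ * π0 x)).toReal + 1, by positivity, fun τ hτ => ?_⟩
  have hf : Measurable fun x => |x| ^ γ * π0 x := by fun_prop
  calc _ = ∫⁻ θ, ENNReal.ofReal (τ ^ γ) *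
        ENNReal.ofReal (τ⁻¹ * (fun x => |x| ^ γ * π0 x) (θ / τ)) := by
        refine lintegral_congr fun θ => ?_
        dsimp only
        rw [← ENNReal.ofReal_mul (by positivity), ← ENNReal.ofReal_mul (by positivity), abs_div,
          abs_of_pos hτ, Real.div_rpow (abs_nonneg _) hτ.le]
        congr 1
        field_simp
    _ = ENNReal.ofReal (τ ^ γ) * ∫⁻ x, ENNReal.ofReal (|x| ^ γ * π0 x) := by
        rw [lintegral_const_mul' _ _ ENNReal.ofReal_ne_top, lintegral_inv_mul_comp_div hf hτ]
    _ ≤ ENNReal.ofReal (τ ^ γ) *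
          ENNReal.ofReal ((∫⁻ x, ENNReal.ofReal (|x| ^ γ * π0 x)).toReal + 1) := by
        gcongr
        rw [ENNReal.le_ofReal_iff_toReal_le hfin (by positivity)]
        linarith
    _ = _ := by rw [← ENNReal.ofReal_mul (by positivity), mul_comm]

/-- A fractional form of exp u ≥ 1 + u: the prior may lack a first moment, so only |θ|^γ can be
afforded. If |y||θ| ≥ 1 or |θ| ≥ 1 the left side is nonpositive. -/
lemma one_sub_le_exp_of_rpow {γ y θ : ℝ} (hγ0 : 0 < γ) (hγ : γ ≤ 1) :
    1 - (|y| ^ γ + 1) * |θ| ^ γ ≤ Real.exp (y * θ - θ ^ 2 / 2) := by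
  have he := Real.exp_pos (y * θ - θ ^ 2 / 2)
  have h1 : (|y| ^ γ + 1) * |θ| ^ γ = (|y| * |θ|) ^ γ + |θ| ^ γ := by
    rw [Real.mul_rpow (abs_nonneg _) (abs_nonneg _)]; ring
  rw [h1]
  have p1 : 0 ≤ (|y| * |θ|) ^ γ := by positivity
  have p2 : 0 ≤ |θ| ^ γ := by positivity
  rcases le_or_gt 1 (|y| * |θ|) with ha | ha
  · linarith [Real.one_le_rpow ha hγ0.le]
  rcases le_or_gt 1 |θ| with hb | hb
  · linarith [Real.one_le_rpow hb hγ0.le]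
  have hle : ∀ t : ℝ, 0 ≤ t → t < 1 → t ≤ t ^ γ := fun t ht0 ht1 => by
    rcases ht0.eq_or_lt with rfl | ht0
    · positivity
    · simpa using Real.rpow_le_rpow_of_exponent_ge ht0 ht1.le hγ
  have e1 := hle _ (by positivity) ha
  have e2 := hle _ (abs_nonneg _) hb
  have e3 : -(|y| * |θ|) ≤ y * θ := by rw [← abs_mul]; exact neg_abs_le _
  have e4 : θ ^ 2 ≤ |θ| := by rw [← sq_abs]; nlinarith [abs_nonneg θ]
  have := Real.add_one_le_exp (y * θ - θ ^ 2 / 2)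
  linarith [abs_nonneg θ]

/-- For small `τ` the marginal density is at least nearly the standard Gaussian density. -/
lemma IsPolyTailDensity.exists_gaussian_le_coordMarginal (h : IsPolyTailDensity π0 α) {γ : ℝ}
    (hγ0 : 0 < γ) (hγ1 : γ < 1) (hγα : γ < α - 1) :
    ∃ C t₀ : ℝ, 0 < C ∧ 0 < t₀ ∧ t₀ ≤ 1 ∧ ∀ τ y : ℝ, 0 < τ → τ ≤ t₀ →
      ENNReal.ofReal (1 - C * τ ^ γ) * gaussianPDF 0 1 y ≤ coordMarginal π0 τ y := by
  have hm := h.measurable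
  have hα := h.one_lt_order
  -- The moment of order γ₀ gives an error of order τ^γ₀; the surplus γ₀ - γ pays for the factor
  -- |y|^γ₀.
  obtain ⟨γ₀, h1, h2⟩ := exists_between (lt_min hγ1 hγα)
  have hγ₀1 : γ₀ < 1 := h2.trans_le (min_le_left _ _)
  have hγ₀0 : 0 < γ₀ := hγ0.trans h1
  obtain ⟨J, hJ, hmom⟩ := h.exists_lintegral_rpow_mul_scaled hγ₀0 (h2.trans_le (min_le_right _ _))
  obtain ⟨c, hc, hslab⟩ := h.exists_le_coordMarginal
  -- Chosen so that εγ₀ = γ₀ - γ: for |y| ≤ τ^(-ε) the loss is exactly τ^(γ-γ₀).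
  set ε : ℝ := 1 - γ / γ₀ with hε
  have hε0 : 0 < ε := by rw [hε, sub_pos, div_lt_one hγ₀0]; exact h1
  -- For |y| > τ^(-ε) the slab bound τ^(α-1)(1+|y|)^(-α) is at least a constant times (1+|y|)^(-k),
  -- which beats the Gaussian density. The extra power in k+1 absorbs the constant B/c, by the
  -- choice of t₀.
  set k : ℝ := α + (α - 1) / ε with hk
  have hk0 : 0 < k + 1 := by positivity
  set B : ℝ := Real.exp ((k + 1) ^ 2 / (4 * (1 / 2))) with hB
  have hB0 : 0 < B := Real.exp_pos _
  refine ⟨2 * J, min 1 ((c / B) ^ ε⁻¹), by positivity, by positivity, min_le_left _ _,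
    fun τ y hτ hτt => ?_⟩
  have hτ1 : τ ≤ 1 := hτt.trans (min_le_left _ _)
  rcases le_or_gt |y| (τ ^ (-ε)) with hy | hy
  · have hbound : (|y| ^ γ₀ + 1) * (J * τ ^ γ₀) ≤ 2 * J * τ ^ γ := by
      have e1 : |y| ^ γ₀ ≤ τ ^ (γ - γ₀) := by
        calc |y| ^ γ₀ ≤ (τ ^ (-ε)) ^ γ₀ := Real.rpow_le_rpow (abs_nonneg _) hy hγ₀0.le
          _ = τ ^ (γ - γ₀) := by
              rw [← Real.rpow_mul hτ.le]; congr 1; rw [hε]; field_simp; ring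
      have e2 : (1 : ℝ) ≤ τ ^ (γ - γ₀) :=
        Real.one_le_rpow_of_pos_of_le_one_of_nonpos hτ hτ1 (by linarith)
      calc _ ≤ (2 * τ ^ (γ - γ₀)) * (J * τ ^ γ₀) := by gcongr; linarith
        _ = 2 * J * (τ ^ (γ - γ₀) * τ ^ γ₀) := by ring
        _ = _ := by rw [← Real.rpow_add hτ]; congr 2; ring
    have hpt : ∀ θ : ℝ, gaussianPDF 0 1 y * ENNReal.ofReal (τ⁻¹ * π0 (θ / τ)) ≤
        coordKernel π0 τ y θ + (gaussianPDF 0 1 y * ENNReal.ofReal (|y| ^ γ₀ + 1)) *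
          (ENNReal.ofReal (|θ| ^ γ₀) * ENNReal.ofReal (τ⁻¹ * π0 (θ / τ))) := by
      intro θ
      rw [coordKernel, ← mul_assoc, ← add_mul]
      gcongr ?_ * _
      rw [gaussianPDF, gaussianPDF, mul_assoc,
        ← ENNReal.ofReal_mul (by positivity), ← ENNReal.ofReal_mul (gaussianPDFReal_nonneg _ _ _),
        ← ENNReal.ofReal_add (gaussianPDFReal_nonneg _ _ _)
          (mul_nonneg (gaussianPDFReal_nonneg _ _ _) (by positivity))]
      apply ENNReal.ofReal_le_ofReal
      have e1 : gaussianPDFReal θ 1 y =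
          gaussianPDFReal 0 1 y * Real.exp (y * θ - θ ^ 2 / 2) := by
        rw [gaussianPDFReal_one, gaussianPDFReal_one, mul_assoc, ← Real.exp_add]
        congr 2; ring
      have e2 := mul_le_mul_of_nonneg_left (one_sub_le_exp_of_rpow (y := y) (θ := θ) hγ₀0 hγ₀1.le)
        (gaussianPDFReal_nonneg 0 1 y)
      rw [e1]
      linarith
    have hint := lintegral_mono (μ := volume) hpt
    rw [lintegral_const_mul _ (by fun_prop), h.lintegral_scaled hτ, mul_one,
      lintegral_add_left (measurable_coordKernel hm _ _), lintegral_const_mul _ (by fun_prop)] at hint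
    have hfin : gaussianPDF 0 1 y ≤ coordMarginal π0 τ y +
        ENNReal.ofReal (2 * J * τ ^ γ) * gaussianPDF 0 1 y := by
      refine hint.trans ?_
      gcongr ?_ + ?_
      · exact le_rfl
      calc _ ≤ gaussianPDF 0 1 y * ENNReal.ofReal (|y| ^ γ₀ + 1) * ENNReal.ofReal (J * τ ^ γ₀) := by
            gcongr; exact hmom τ hτ
        _ = gaussianPDF 0 1 y * ENNReal.ofReal ((|y| ^ γ₀ + 1) * (J * τ ^ γ₀)) := by
            rw [mul_assoc, ← ENNReal.ofReal_mul (by positivity)]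
        _ ≤ _ := by rw [mul_comm]; gcongr
    rw [ENNReal.ofReal_sub _ (by positivity), ENNReal.ofReal_one,
      ENNReal.sub_mul (fun _ _ => gaussianPDF_ne_top), one_mul]
    exact tsub_le_iff_right.2 hfin
  · have hy0 : 0 < |y| := lt_of_le_of_lt (by positivity) hy
    have hpos : 0 < 1 + |y| := by positivity
    calc _ ≤ ENNReal.ofReal 1 * gaussianPDF 0 1 y := by
          gcongr
          have : 0 < 2 * J * τ ^ γ := by positivity
          linarith
      _ ≤ ENNReal.ofReal (c * τ ^ (α - 1) * (1 + |y|) ^ (-α)) := by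
          rw [ENNReal.ofReal_one, one_mul, gaussianPDF]
          apply ENNReal.ofReal_le_ofReal
          refine (gaussianPDFReal_le_exp 0 y).trans ?_
          have e1 : (1 + |y|) ^ (k + 1) ≤ B * Real.exp (1 / 2 * |y| ^ 2) :=
            one_add_rpow_le_exp hk0.le (by norm_num) (abs_nonneg y)
          have e2 : B ≤ c * (1 + |y|) := by
            have : (c / B) ≥ τ ^ ε := by
              have := Real.rpow_le_rpow hτ.le (hτt.trans (min_le_right _ _)) hε0.le
              rwa [← Real.rpow_mul (by positivity), inv_mul_cancel₀ hε0.ne', Real.rpow_one] at this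
            rw [Real.rpow_neg hτ.le] at hy
            have h3 : B ≤ c * (τ ^ ε)⁻¹ := by
              rw [← div_eq_mul_inv, le_div_iff₀ (by positivity)]
              rw [ge_iff_le, le_div_iff₀ hB0] at this
              linarith
            refine h3.trans ?_
            gcongr
            linarith
          have e3 : (1 + |y|) ^ (-((α - 1) / ε)) ≤ τ ^ (α - 1) := by
            calc (1 + |y|) ^ (-((α - 1) / ε)) ≤ (τ ^ (-ε)) ^ (-((α - 1) / ε)) :=
                  Real.rpow_le_rpow_of_nonpos (by positivity) (by linarith)
                    (neg_nonpos.2 (by apply div_nonneg <;> linarith))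
              _ = τ ^ (α - 1) := by
                  rw [← Real.rpow_mul hτ.le]; congr 1; field_simp
          have e4 : Real.exp (-(y - 0) ^ 2 / 2) = (Real.exp (1 / 2 * |y| ^ 2))⁻¹ := by
            rw [← Real.exp_neg, sq_abs]; congr 1; ring
          rw [e4]
          have e5 : (Real.exp (1 / 2 * |y| ^ 2))⁻¹ ≤ c * (1 + |y|) * ((1 + |y|) ^ (k + 1))⁻¹ := by
            rw [← div_eq_mul_inv, le_div_iff₀ (by positivity), inv_mul_le_iff₀ (Real.exp_pos _)]
            calc _ ≤ B * Real.exp (1 / 2 * |y| ^ 2) := e1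
              _ ≤ c * (1 + |y|) * Real.exp (1 / 2 * |y| ^ 2) := by gcongr
              _ = _ := mul_comm _ _
          refine e5.trans ?_
          calc _ = c * (1 + |y|) ^ (-((α - 1) / ε)) * (1 + |y|) ^ (-α) := by
                rw [Real.rpow_add hpos, Real.rpow_one, hk, Real.rpow_add hpos, Real.rpow_neg hpos.le,
                  Real.rpow_neg hpos.le]
                field_simp
            _ ≤ _ := by gcongr
      _ ≤ _ := hslab τ y hτ hτ1

/-- Unnormalised posterior moments of one coordinate, small when `τ` is small. -/
lemma IsPolyTailDensity.exists_lintegral_moment_le (h : IsPolyTailDensity π0 α)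
    (hpole : ∃ β K : ℝ, 0 < β ∧ ∀ x : ℝ, 0 < |x| → |x| ≤ 1 → π0 x ≤ K * |x| ^ (β - 1))
    {γ : ℝ} (hγ0 : 0 < γ) (hγ1 : γ < 1) (hγα : γ < α - 1) :
    ∃ C : ℝ, 0 < C ∧ ∀ L τ y : ℝ, 1 ≤ L → 0 < τ →
      ∫⁻ θ, ENNReal.ofReal (L * |θ| + θ ^ 2) * coordKernel π0 τ y θ ≤
        ENNReal.ofReal (C * L * τ ^ γ * (1 + |y|)) := by
  obtain ⟨β, K, hβ, hβ1, hK, hb⟩ := h.exists_rpow_bound hpole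
  obtain ⟨G, hG, hg⟩ := exists_lintegral_rpow_neg_gaussian_le hγ0 hγ1
  set E : ℝ := Real.exp 1 * √(Real.pi / (1 / 4)) with hE
  refine ⟨K * (2 * G + E + 1), by positivity, fun L τ y hL hτ => ?_⟩
  have hpt : ∀ θ : ℝ, θ ≠ 0 → ENNReal.ofReal (L * |θ| + θ ^ 2) * coordKernel π0 τ y θ ≤
      ENNReal.ofReal (K * L * τ ^ γ) * (ENNReal.ofReal 2 *
        (ENNReal.ofReal (|θ| ^ (-γ)) * gaussianPDF θ 1 y) + ENNReal.ofReal |y| * gaussianPDF θ 1 y +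
        ENNReal.ofReal (Real.exp 1) * ENNReal.ofReal (Real.exp (-(1 / 4) * (y - θ) ^ 2))) := by
    intro θ hθ
    have hθ0 : 0 < |θ| := abs_pos.2 hθ
    have hφ := gaussianPDFReal_nonneg θ 1 y
    rw [coordKernel, gaussianPDF, mul_left_comm, ← ENNReal.ofReal_mul (by positivity),
      ← ENNReal.ofReal_mul hφ, ← ENNReal.ofReal_mul (by positivity),
      ← ENNReal.ofReal_mul (by positivity), ← ENNReal.ofReal_mul (by positivity),
      ← ENNReal.ofReal_mul (by positivity), ← ENNReal.ofReal_add (by positivity) (by positivity),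
      ← ENNReal.ofReal_add (by positivity) (by positivity), ← ENNReal.ofReal_mul (by positivity)]
    apply ENNReal.ofReal_le_ofReal
    -- With this exponent the prior supplies τ^γ, and multiplying by |θ| leaves the integrable
    -- singularity |θ|^(-γ).
    have e1 := hb (1 + γ) (by linarith) (by linarith) τ hτ θ hθ
    rw [add_sub_cancel_left] at e1
    have e2 : (L * |θ| + θ ^ 2) * |θ| ^ (-(1 + γ)) ≤ L * (2 * |θ| ^ (-γ) + |θ|) := by
      have e3 : |θ| ^ (-(1 + γ)) = |θ| ^ (-γ) * |θ|⁻¹ := by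
        rw [neg_add, add_comm, Real.rpow_add hθ0, Real.rpow_neg_one]
      have e4 : |θ| * |θ| ^ (-γ) ≤ |θ| ^ (-γ) + |θ| := by
        have p : 0 < |θ| ^ (-γ) := by positivity
        rcases le_total |θ| 1 with h1 | h1
        · nlinarith
        · have : |θ| ^ (-γ) ≤ 1 := Real.rpow_le_one_of_one_le_of_nonpos h1 (by linarith)
          nlinarith
      have p : 0 < |θ| ^ (-γ) := by positivity
      rw [e3, ← sq_abs θ]
      calc _ = L * |θ| ^ (-γ) + |θ| * |θ| ^ (-γ) := by field_simp
        _ ≤ L * |θ| ^ (-γ) + L * (|θ| ^ (-γ) + |θ|) := by nlinarith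
        _ = _ := by ring
    have e5 : |θ| * gaussianPDFReal θ 1 y ≤ |y| * gaussianPDFReal θ 1 y +
        Real.exp 1 * Real.exp (-(1 / 4) * (y - θ) ^ 2) := by
      have e6 : |θ| ≤ |y| + |y - θ| := by linarith [abs_sub_abs_le_abs_sub θ y, abs_sub_comm θ y]
      have e7 : |y - θ| * gaussianPDFReal θ 1 y ≤
          Real.exp 1 * Real.exp (-(1 / 4) * (y - θ) ^ 2) := by
        have := one_add_rpow_le_exp (a := 1) (κ := 1 / 4) (by norm_num) (by norm_num)
          (abs_nonneg (y - θ))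
        rw [Real.rpow_one] at this
        calc _ ≤ (Real.exp (1 ^ 2 / (4 * (1 / 4))) * Real.exp (1 / 4 * |y - θ| ^ 2)) *
              Real.exp (-(y - θ) ^ 2 / 2) :=
              mul_le_mul (by linarith) (gaussianPDFReal_le_exp θ y) hφ (by positivity)
          _ = _ := by
              rw [mul_assoc, ← Real.exp_add, sq_abs]
              norm_num
              ring_nf
      nlinarith
    calc gaussianPDFReal θ 1 y * ((L * |θ| + θ ^ 2) * (τ⁻¹ * π0 (θ / τ)))
        ≤ gaussianPDFReal θ 1 y * ((L * |θ| + θ ^ 2) * (K * τ ^ γ * |θ| ^ (-(1 + γ)))) := by gcongr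
      _ = K * τ ^ γ * gaussianPDFReal θ 1 y * ((L * |θ| + θ ^ 2) * |θ| ^ (-(1 + γ))) := by ring
      _ ≤ K * τ ^ γ * gaussianPDFReal θ 1 y * (L * (2 * |θ| ^ (-γ) + |θ|)) := by gcongr
      _ = K * L * τ ^ γ * (2 * (|θ| ^ (-γ) * gaussianPDFReal θ 1 y) +
            |θ| * gaussianPDFReal θ 1 y) := by ring
      _ ≤ K * L * τ ^ γ * (2 * (|θ| ^ (-γ) * gaussianPDFReal θ 1 y) +
            (|y| * gaussianPDFReal θ 1 y +
              Real.exp 1 * Real.exp (-(1 / 4) * (y - θ) ^ 2))) := by gcongr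
      _ = _ := by ring
  refine (lintegral_mono_ae ((Measure.ae_ne volume (0 : ℝ)).mono hpt)).trans ?_
  rw [lintegral_const_mul' _ _ ENNReal.ofReal_ne_top, lintegral_add_right _ (by fun_prop),
    lintegral_add_right _ (by fun_prop), lintegral_const_mul' _ _ ENNReal.ofReal_ne_top,
    lintegral_const_mul' _ _ ENNReal.ofReal_ne_top, lintegral_const_mul' _ _ ENNReal.ofReal_ne_top,
    lintegral_gaussianPDF_mean, mul_one, lintegral_exp_neg_mul_sq_le (by norm_num)]
  calc _ ≤ ENNReal.ofReal (K * L * τ ^ γ) * (ENNReal.ofReal 2 * ENNReal.ofReal G +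
        ENNReal.ofReal |y| + ENNReal.ofReal (Real.exp 1) *
          ENNReal.ofReal (√(Real.pi / (1 / 4)))) := by gcongr; exact hg y
    _ = ENNReal.ofReal (K * L * τ ^ γ * (2 * G + |y| + E)) := by
        rw [← ENNReal.ofReal_mul (by positivity), ← ENNReal.ofReal_mul (by positivity),
          ← ENNReal.ofReal_add (by positivity) (by positivity),
          ← ENNReal.ofReal_add (by positivity) (by positivity), ← ENNReal.ofReal_mul (by positivity)]
    _ ≤ _ := by
        apply ENNReal.ofReal_le_ofReal
        have : 2 * G + |y| + E ≤ (2 * G + E + 1) * (1 + |y|) := by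
          have : 0 < E := by positivity
          nlinarith [abs_nonneg y]
        calc _ ≤ K * L * τ ^ γ * ((2 * G + E + 1) * (1 + |y|)) := by gcongr
          _ = _ := by ring

/-- Posterior moments of one coordinate when `τ` is not too small. -/
lemma IsPolyTailDensity.exists_lintegral_moment_le_log (h : IsPolyTailDensity π0 α)
    (hpole : ∃ β K : ℝ, 0 < β ∧ ∀ x : ℝ, 0 < |x| → |x| ≤ 1 → π0 x ≤ K * |x| ^ (β - 1))
    {c : ℝ} (hc : 0 ≤ c) :
    ∃ C : ℝ, 0 < C ∧ ∀ L τ y : ℝ, 1 ≤ L → 0 < τ → τ ≤ 1 →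
      τ ^ (-(α - 1)) ≤ Real.exp (c * L ^ 2) →
      ∫⁻ θ, ENNReal.ofReal (L * |θ| + θ ^ 2) * coordKernel π0 τ y θ ≤
        ENNReal.ofReal (C * L ^ 2 * (1 + y ^ 2)) * coordMarginal π0 τ y := by
  obtain ⟨Q, hQ, hexp⟩ := h.exists_lintegral_exp_sq_le hpole (l := 1 / 2) (by norm_num)
  have hm := h.measurable
  have hlog : 0 ≤ Real.log Q := Real.log_nonneg hQ
  refine ⟨21 + 16 * (Real.log Q + c), by positivity, fun L τ y hL hτ hτ1 hτL => ?_⟩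
  -- Used through u ≤ a + exp(-a) exp(u) with u = (θ-y)²/4. This a makes exp(-a)Qτ^(-(α-1)) ≤ 1, so
  -- the polynomial moment costs only the logarithm of the exponential one.
  set a : ℝ := Real.log Q + c * L ^ 2 with ha
  have ha0 : 0 ≤ a := by positivity
  have hpt : ∀ θ : ℝ, ENNReal.ofReal (L * |θ| + θ ^ 2) * coordKernel π0 τ y θ ≤
      ENNReal.ofReal (L ^ 2 + 4 * y ^ 2 + 16 * a) * coordKernel π0 τ y θ +
      ENNReal.ofReal (16 * Real.exp (-a)) *
        (ENNReal.ofReal (Real.exp (1 / 2 / 2 * (θ - y) ^ 2)) * coordKernel π0 τ y θ) := by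
    intro θ
    rw [← mul_assoc, ← add_mul, ← ENNReal.ofReal_mul (by positivity),
      ← ENNReal.ofReal_add (by positivity) (by positivity)]
    gcongr ENNReal.ofReal ?_ * _
    have e1 : (θ - y) ^ 2 / 4 ≤ a + Real.exp (-a) * Real.exp (1 / 2 / 2 * (θ - y) ^ 2) := by
      rw [← Real.exp_add]
      have := Real.add_one_le_exp (-a + 1 / 2 / 2 * (θ - y) ^ 2)
      linarith
    have e2 : L * |θ| ≤ L ^ 2 + θ ^ 2 := by
      rw [← sq_abs θ]; nlinarith [sq_nonneg (L - |θ|), abs_nonneg θ]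
    nlinarith [sq_nonneg (θ - 2 * y)]
  refine (lintegral_mono hpt).trans ?_
  rw [lintegral_add_left ((measurable_coordKernel hm _ _).const_mul _),
    lintegral_const_mul' _ _ ENNReal.ofReal_ne_top, lintegral_const_mul' _ _ ENNReal.ofReal_ne_top]
  calc _ ≤ ENNReal.ofReal (L ^ 2 + 4 * y ^ 2 + 16 * a) * coordMarginal π0 τ y +
        ENNReal.ofReal (16 * Real.exp (-a)) *
          (ENNReal.ofReal (Q * τ ^ (-(α - 1))) * coordMarginal π0 τ y) := by
        gcongr ?_ + _ * ?_
        · exact le_rfl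
        · exact hexp τ y hτ hτ1
    _ = ENNReal.ofReal (L ^ 2 + 4 * y ^ 2 + 16 * a + 16 * Real.exp (-a) * (Q * τ ^ (-(α - 1)))) *
          coordMarginal π0 τ y := by
        rw [← mul_assoc, ← add_mul, ← ENNReal.ofReal_mul (by positivity),
          ← ENNReal.ofReal_add (by positivity) (by positivity)]
    _ ≤ _ := by
        gcongr ENNReal.ofReal ?_ * _
        have e1 : Real.exp (-a) * (Q * τ ^ (-(α - 1))) ≤ 1 := by
          rw [Real.exp_neg, inv_mul_le_iff₀ (Real.exp_pos _), mul_one, ha, Real.exp_add,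
            Real.exp_log (by linarith)]
          gcongr
        have e2 : 1 ≤ L ^ 2 := one_le_pow₀ hL
        have e3 : Real.log Q ≤ Real.log Q * L ^ 2 := le_mul_of_one_le_right hlog e2
        have e4 : a ≤ (Real.log Q + c) * L ^ 2 := by rw [ha]; linarith
        have e5 : 0 ≤ (Real.log Q + c) * L ^ 2 * y ^ 2 := by positivity
        have e6 : y ^ 2 ≤ L ^ 2 * y ^ 2 := le_mul_of_one_le_left (sq_nonneg _) e2
        nlinarith

/-! ### Posterior bounds for the whole vector given τ. -/

variable {n : ℕ}

/-- Marginal likelihood of `y`, restricted to parameters in `A`, given `τ`. -/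
noncomputable def marginalGiven (π0 : ℝ → ℝ) (τ : ℝ) (y : Fin n → ℝ) (A : Set (Fin n → ℝ)) :
    ℝ≥0∞ :=
  ∫⁻ θ in A, likelihood y θ * priorDensity π0 τ θ

lemma marginalGiven_eq (τ : ℝ) (y : Fin n → ℝ) (A : Set (Fin n → ℝ)) :
    marginalGiven π0 τ y A = ∫⁻ θ in A, ∏ i, coordKernel π0 τ (y i) (θ i) := by
  simp_rw [marginalGiven, likelihood, priorDensity, ← Finset.prod_mul_distrib]
  rfl

lemma lintegral_volume_pi_prod (f : Fin n → ℝ → ℝ≥0∞) (hf : ∀ i, Measurable (f i)) :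
    ∫⁻ x : Fin n → ℝ, ∏ i, f i (x i) = ∏ i, ∫⁻ x, f i x := by
  rw [volume_pi]
  exact lintegral_pi_prod _ f hf

lemma marginalGiven_univ (h : Measurable π0) (τ : ℝ) (y : Fin n → ℝ) :
    marginalGiven π0 τ y Set.univ = ∏ i, coordMarginal π0 τ (y i) := by
  rw [marginalGiven_eq, setLIntegral_univ,
    lintegral_volume_pi_prod _ fun i => measurable_coordKernel h _ _]
  rfl

lemma measurable_prod_coordMarginal (h : Measurable π0) (y : Fin n → ℝ) :
    Measurable fun τ => ∏ i, coordMarginal π0 τ (y i) := by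
  fun_prop

/-- Chernoff bound for the residuals on `S`, given `τ`. -/
lemma marginalGiven_sq_le (h : Measurable π0) (S : Finset (Fin n)) {τ l R q : ℝ} (hl : 0 ≤ l)
    (hq : 0 ≤ q)
    (hexp : ∀ y : ℝ, ∫⁻ θ, ENNReal.ofReal (Real.exp (l / 2 * (θ - y) ^ 2)) *
      coordKernel π0 τ y θ ≤ ENNReal.ofReal q * coordMarginal π0 τ y) (y : Fin n → ℝ) :
    marginalGiven π0 τ y {θ | R ≤ ∑ i ∈ S, (θ i - y i) ^ 2} ≤
      ENNReal.ofReal (Real.exp (-(l / 2 * R)) * q ^ S.card) *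
        marginalGiven π0 τ y Set.univ := by
  classical
  set f : Fin n → ℝ → ℝ≥0∞ := fun i t =>
    (if i ∈ S then ENNReal.ofReal (Real.exp (l / 2 * (t - y i) ^ 2)) else 1) *
      coordKernel π0 τ (y i) t with hf
  have hfm : ∀ i, Measurable (f i) := fun i => by
    by_cases hi : i ∈ S
    · simp only [hf, hi, if_true]; fun_prop
    · simp only [hf, hi, if_false]; fun_prop
  have hA : MeasurableSet {θ : Fin n → ℝ | R ≤ ∑ i ∈ S, (θ i - y i) ^ 2} :=
    measurableSet_le measurable_const (by fun_prop)
  calc _ ≤ ∫⁻ θ in {θ : Fin n → ℝ | R ≤ ∑ i ∈ S, (θ i - y i) ^ 2},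
        ENNReal.ofReal (Real.exp (-(l / 2 * R))) * ∏ i, f i (θ i) := by
        rw [marginalGiven_eq]
        refine setLIntegral_mono' hA fun θ hθ => ?_
        rw [Finset.prod_mul_distrib, ← mul_assoc, Finset.prod_ite_mem, Finset.univ_inter,
          ← ENNReal.ofReal_prod_of_nonneg (fun _ _ => (Real.exp_pos _).le), ← Real.exp_sum,
          ← ENNReal.ofReal_mul (Real.exp_pos _).le, ← Real.exp_add, ← Finset.mul_sum]
        refine le_mul_of_one_le_left' ?_
        rw [← ENNReal.ofReal_one]
        refine ENNReal.ofReal_le_ofReal (Real.one_le_exp ?_)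
        have : l / 2 * R ≤ l / 2 * ∑ i ∈ S, (θ i - y i) ^ 2 :=
          mul_le_mul_of_nonneg_left hθ (by positivity)
        linarith
    _ ≤ ∫⁻ θ : Fin n → ℝ, ENNReal.ofReal (Real.exp (-(l / 2 * R))) * ∏ i, f i (θ i) :=
        setLIntegral_le_lintegral _ _
    _ = ENNReal.ofReal (Real.exp (-(l / 2 * R))) * ∏ i, ∫⁻ t, f i t := by
        rw [lintegral_const_mul' _ _ ENNReal.ofReal_ne_top, lintegral_volume_pi_prod f hfm]
    _ ≤ ENNReal.ofReal (Real.exp (-(l / 2 * R))) *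
          ∏ i, ((if i ∈ S then ENNReal.ofReal q else 1) * coordMarginal π0 τ (y i)) := by
        gcongr with i
        by_cases hi : i ∈ S
        · simpa [hf, hi] using hexp (y i)
        · simp [hf, hi, coordMarginal]
    _ = _ := by
        rw [Finset.prod_mul_distrib, Finset.prod_ite_mem, Finset.univ_inter, Finset.prod_const,
          marginalGiven_univ h, ENNReal.ofReal_mul (Real.exp_pos _).le, ENNReal.ofReal_pow hq,
          mul_assoc]

/-- Markov bound for the coordinates in `N`, given `τ`. -/
lemma marginalGiven_sum_le (h : Measurable π0) (N : Finset (Fin n)) {τ Δ : ℝ} {ψ : ℝ → ℝ}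
    (hψ : Measurable ψ) (hψ0 : ∀ t, 0 ≤ ψ t) (hΔ : 0 < Δ) {b : ℝ → ℝ≥0∞}
    (hb : ∀ y : ℝ, ∫⁻ θ, ENNReal.ofReal (ψ θ) * coordKernel π0 τ y θ ≤
      b y * coordMarginal π0 τ y) (y : Fin n → ℝ) :
    marginalGiven π0 τ y {θ | Δ ≤ ∑ i ∈ N, ψ (θ i)} ≤
      (ENNReal.ofReal Δ⁻¹ * ∑ i ∈ N, b (y i)) * marginalGiven π0 τ y Set.univ := by
  classical
  set f : Fin n → Fin n → ℝ → ℝ≥0∞ := fun i j t =>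
    (if j = i then ENNReal.ofReal (ψ t) else 1) * coordKernel π0 τ (y j) t with hf
  have hfm : ∀ i j, Measurable (f i j) := fun i j => by
    by_cases hi : j = i
    · simp only [hf, hi, if_true]; fun_prop
    · simp only [hf, hi, if_false]; fun_prop
  have hA : MeasurableSet {θ : Fin n → ℝ | Δ ≤ ∑ i ∈ N, ψ (θ i)} :=
    measurableSet_le measurable_const (by fun_prop)
  calc _ ≤ ∫⁻ θ in {θ : Fin n → ℝ | Δ ≤ ∑ i ∈ N, ψ (θ i)},
        ENNReal.ofReal Δ⁻¹ * ∑ i ∈ N, ∏ j, f i j (θ j) := by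
        rw [marginalGiven_eq]
        refine setLIntegral_mono' hA fun θ hθ => ?_
        have e : ∀ i, ∏ j, f i j (θ j) =
            ENNReal.ofReal (ψ (θ i)) * ∏ j, coordKernel π0 τ (y j) (θ j) := fun i => by
          rw [Finset.prod_mul_distrib, Finset.prod_ite_eq' Finset.univ i, if_pos (Finset.mem_univ i)]
        simp_rw [e]
        rw [← Finset.sum_mul, ← mul_assoc, ← ENNReal.ofReal_sum_of_nonneg (fun _ _ => hψ0 _),
          ← ENNReal.ofReal_mul (by positivity)]
        refine le_mul_of_one_le_left' ?_
        rw [← ENNReal.ofReal_one]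
        refine ENNReal.ofReal_le_ofReal ?_
        rw [← div_eq_inv_mul, one_le_div hΔ]
        exact hθ
    _ ≤ ∫⁻ θ : Fin n → ℝ, ENNReal.ofReal Δ⁻¹ * ∑ i ∈ N, ∏ j, f i j (θ j) :=
        setLIntegral_le_lintegral _ _
    _ = ENNReal.ofReal Δ⁻¹ * ∑ i ∈ N, ∏ j, ∫⁻ t, f i j t := by
        rw [lintegral_const_mul' _ _ ENNReal.ofReal_ne_top, lintegral_finsetSum]
        · simp_rw [lintegral_volume_pi_prod (f _) (hfm _)]
        · exact fun i _ => Finset.measurable_prod _ fun j _ =>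
            (hfm i j).comp (measurable_pi_apply j)
    _ ≤ ENNReal.ofReal Δ⁻¹ * ∑ i ∈ N, ∏ j,
          ((if j = i then b (y i) else 1) * coordMarginal π0 τ (y j)) := by
        gcongr with i _ j
        by_cases hi : j = i
        · subst hi; simpa [hf] using hb (y j)
        · simp [hf, hi, coordMarginal]
    _ = _ := by
        have e : ∀ i, ∏ j, ((if j = i then b (y i) else 1) * coordMarginal π0 τ (y j)) =
            b (y i) * ∏ j, coordMarginal π0 τ (y j) := fun i => by
          rw [Finset.prod_mul_distrib, Finset.prod_ite_eq' Finset.univ i, if_pos (Finset.mem_univ i)]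
        simp_rw [e]
        rw [← Finset.sum_mul, marginalGiven_univ h, mul_assoc]

lemma posteriorProb_le_one (P : Measure ℝ) (y : Fin n → ℝ) (A : Set (Fin n → ℝ)) :
    posteriorProb π0 P y A ≤ 1 := by
  refine (ENNReal.div_le_div_right ?_ _).trans ENNReal.div_self_le_one
  exact lintegral_mono fun τ => lintegral_mono_set (Set.subset_univ A)

/-- Posterior bound from a bound that is uniform over `τ ∈ [a, b)`. -/
lemma posteriorProb_le (h : Measurable π0) {P : Measure ℝ} {a b : ℝ}
    (ha : P (Set.Iio a) = 0) {y : Fin n → ℝ} {A : Set (Fin n → ℝ)} {k : ℝ≥0∞}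
    (hk : ∀ τ, a ≤ τ → τ < b → marginalGiven π0 τ y A ≤ k * marginalGiven π0 τ y Set.univ) :
    posteriorProb π0 P y A ≤ k +
      (∫⁻ τ in Set.Ici b, ∏ i, coordMarginal π0 τ (y i) ∂P) / marginal π0 P y Set.univ := by
  have hmono : ∀ τ, marginalGiven π0 τ y A ≤ marginalGiven π0 τ y Set.univ :=
    fun τ => lintegral_mono_set (Set.subset_univ A)
  have hD : marginal π0 P y Set.univ = ∫⁻ τ, marginalGiven π0 τ y Set.univ ∂P := rfl
  have key : marginal π0 P y A ≤ k * marginal π0 P y Set.univ +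
      ∫⁻ τ in Set.Ici b, ∏ i, coordMarginal π0 τ (y i) ∂P := by
    have hm : Measurable fun τ => marginalGiven π0 τ y Set.univ := by
      simp_rw [marginalGiven_univ h]
      exact measurable_prod_coordMarginal h y
    calc marginal π0 P y A = ∫⁻ τ, marginalGiven π0 τ y A ∂P := rfl
      _ ≤ ∫⁻ τ, (k * marginalGiven π0 τ y Set.univ +
            (Set.Ici b).indicator (fun τ => marginalGiven π0 τ y Set.univ) τ) ∂P := by
          refine lintegral_mono_ae ?_
          have : ∀ᵐ τ ∂P, τ ∉ Set.Iio a := measure_eq_zero_iff_ae_notMem.1 ha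
          filter_upwards [this] with τ hτ
          rcases lt_or_ge τ b with hb | hb
          · exact (hk τ (not_lt.1 hτ) hb).trans le_self_add
          · rw [Set.indicator_of_mem (Set.mem_Ici.2 hb)]
            exact (hmono τ).trans le_add_self
      _ = _ := by
          rw [lintegral_add_left (hm.const_mul k), lintegral_const_mul _ hm,
            lintegral_indicator measurableSet_Ici, hD]
          simp_rw [marginalGiven_univ h]
  rw [posteriorProb]
  refine (ENNReal.div_le_div_right key _).trans ?_
  rw [ENNReal.add_div, mul_div_assoc]
  gcongr
  exact mul_le_of_le_one_right' ENNReal.div_self_le_one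

/-! ### Comparison of evidence through likelihood ratios. -/

/-- Likelihood ratio of one observation between the marginal model and the null model. -/
noncomputable def coordRatio (π0 : ℝ → ℝ) (τ y : ℝ) : ℝ≥0∞ :=
  coordMarginal π0 τ y / gaussianPDF 0 1 y

@[fun_prop]
lemma measurable_coordRatio_comp {β : Type*} [MeasurableSpace β] (h : Measurable π0)
    {f g : β → ℝ} (hf : Measurable f) (hg : Measurable g) :
    Measurable fun a => coordRatio π0 (f a) (g a) := by
  unfold coordRatio
  fun_prop

lemma coordMarginal_eq (τ y : ℝ) :
    coordMarginal π0 τ y = gaussianPDF 0 1 y * coordRatio π0 τ y := by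
  rw [coordRatio, ENNReal.mul_div_cancel (gaussianPDF_pos 0 one_ne_zero y).ne' gaussianPDF_ne_top]

/-- A ratio of probability densities integrates to one against its denominator. -/
lemma IsPolyTailDensity.lintegral_coordRatio (h : IsPolyTailDensity π0 α) {τ : ℝ} (hτ : 0 < τ) :
    ∫⁻ y, coordRatio π0 τ y ∂(gaussianReal 0 1) = 1 := by
  have hπ := h.measurable
  have hm : Measurable fun y => coordRatio π0 τ y := by fun_prop
  rw [gaussianReal_of_var_ne_zero 0 one_ne_zero,
    lintegral_withDensity_eq_lintegral_mul _ (measurable_gaussianPDF _ _) hm]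
  simp only [Pi.mul_apply, ← coordMarginal_eq]
  exact h.lintegral_coordMarginal hτ

instance (θ' : Fin n → ℝ) : IsProbabilityMeasure (dataLaw θ') := by
  unfold dataLaw; infer_instance

lemma lintegral_dataLaw_prod (θ' : Fin n → ℝ) (f : Fin n → ℝ → ℝ≥0∞)
    (hf : ∀ i, Measurable (f i)) :
    ∫⁻ y, ∏ i, f i (y i) ∂(dataLaw θ') = ∏ i, ∫⁻ t, f i t ∂(gaussianReal (θ' i) 1) :=
  lintegral_pi_prod _ f hf

lemma lintegral_dataLaw_eval (θ' : Fin n → ℝ) (i : Fin n) {f : ℝ → ℝ≥0∞} (hf : Measurable f) :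
    ∫⁻ y, f (y i) ∂(dataLaw θ') = ∫⁻ t, f t ∂(gaussianReal (θ' i) 1) :=
  (measurePreserving_eval (fun i => gaussianReal (θ' i) 1) i).lintegral_comp hf

lemma IsPolyTailDensity.lintegral_prod_coordRatio (h : IsPolyTailDensity π0 α) {τ : ℝ}
    (hτ : 0 < τ) (θ' : Fin n → ℝ) (N : Finset (Fin n)) (hN : ∀ i ∈ N, θ' i = 0) :
    ∫⁻ y, ∏ i ∈ N, coordRatio π0 τ (y i) ∂(dataLaw θ') = 1 := by
  classical
  have hπ := h.measurable
  have hm : Measurable fun y => coordRatio π0 τ y := by fun_prop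
  have e : ∀ y : Fin n → ℝ, ∏ i ∈ N, coordRatio π0 τ (y i) =
      ∏ i, (fun i t => if i ∈ N then coordRatio π0 τ t else 1) i (y i) := fun y => by
    rw [Finset.prod_ite_mem, Finset.univ_inter]
  rw [lintegral_congr e]
  refine (lintegral_dataLaw_prod θ' (fun i t => if i ∈ N then coordRatio π0 τ t else 1)
    fun i => ?_).trans ?_
  rotate_left
  · refine Finset.prod_eq_one fun i _ => ?_
    by_cases hi : i ∈ N
    · simp only [hi, if_true, hN i hi]
      exact h.lintegral_coordRatio hτ
    · simp [hi]
  · by_cases hi : i ∈ N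
    · simpa only [hi, if_true] using hm
    · simp only [hi, if_false, measurable_const]

/-- Expected weighted likelihood ratio over a set of values of `τ`, on a set `G` of observations
outside of which large values of `τ` are not controlled. -/
lemma IsPolyTailDensity.lintegral_weighted_ratio_le (h : IsPolyTailDensity π0 α)
    (θ' : Fin n → ℝ) (N : Finset (Fin n)) (hN : ∀ i ∈ N, θ' i = 0) (P : Measure ℝ)
    [SFinite P] {b T : ℝ} (hb : 0 < b) {w : ℝ → ℝ≥0∞} {V : ℝ≥0∞} (hV : V ≠ ⊤)
    {G : Set (Fin n → ℝ)} (hG : MeasurableSet G) (hw1 : ∀ τ, b ≤ τ → τ ≤ T → w τ ≤ V)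
    (hw2 : ∀ τ, b ≤ τ → T < τ → ∀ y ∈ G, w τ * ∏ i ∈ N, coordRatio π0 τ (y i) ≤ V) :
    ∫⁻ y in G, ∫⁻ τ in Set.Ici b, w τ * ∏ i ∈ N, coordRatio π0 τ (y i) ∂P ∂(dataLaw θ') ≤
      2 * V * P (Set.Ici b) := by
  have hπ := h.measurable
  have hm : Measurable fun p : (Fin n → ℝ) × ℝ => ∏ i ∈ N, coordRatio π0 p.2 (p.1 i) := by
    fun_prop
  -- The summand with the ratios covers τ ≤ T, the summand 1 covers τ > T. Once the sum dominates, G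
  -- can be dropped, and after Tonelli each summand has mean V.
  calc _ ≤ ∫⁻ y in G, ∫⁻ τ in Set.Ici b, V * (∏ i ∈ N, coordRatio π0 τ (y i) + 1) ∂P
        ∂(dataLaw θ') := by
        refine setLIntegral_mono' hG fun y hy => setLIntegral_mono' measurableSet_Ici fun τ hτ => ?_
        rw [mul_add, mul_one]
        rcases le_or_gt τ T with hT | hT
        · refine le_trans ?_ le_self_add
          gcongr
          exact hw1 τ hτ hT
        · exact (hw2 τ hτ hT y hy).trans le_add_self
    _ ≤ ∫⁻ y, ∫⁻ τ in Set.Ici b, V * (∏ i ∈ N, coordRatio π0 τ (y i) + 1) ∂P ∂(dataLaw θ') :=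
        setLIntegral_le_lintegral _ _
    _ = ∫⁻ τ in Set.Ici b, ∫⁻ y, V * (∏ i ∈ N, coordRatio π0 τ (y i) + 1) ∂(dataLaw θ') ∂P := by
        rw [lintegral_lintegral_swap]
        exact ((hm.add_const 1).const_mul V).aemeasurable
    _ = ∫⁻ τ in Set.Ici b, 2 * V ∂P := by
        refine setLIntegral_congr_fun measurableSet_Ici fun τ hτ => ?_
        rw [lintegral_const_mul' _ _ hV, lintegral_add_right _ measurable_const,
          h.lintegral_prod_coordRatio (hb.trans_le hτ) θ' N hN, lintegral_one, measure_univ,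
          one_add_one_eq_two, mul_comm]
    _ = _ := by rw [setLIntegral_const]

/-- Both integrals are bounded by multiples of the same y-dependent weight: (1+|y_i|)^(-α) on S and
the null density off S. It cancels, so the signal observations disappear from the bound. -/
lemma evidence_ratio_le (h : Measurable π0) (P : Measure ℝ) (S : Finset (Fin n)) {d u b : ℝ}
    (hd : 0 < d) {I : Set ℝ} (hI : MeasurableSet I) {v : ℝ → ℝ≥0∞}
    (hslab : ∀ τ ∈ I, ∀ y, ENNReal.ofReal (d * (1 + |y|) ^ (-α)) ≤ coordMarginal π0 τ y)
    (hspike : ∀ τ ∈ I, ∀ y, ENNReal.ofReal u * gaussianPDF 0 1 y ≤ coordMarginal π0 τ y)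
    (hup : ∀ τ, b ≤ τ → ∀ y, coordMarginal π0 τ y ≤ v τ * ENNReal.ofReal ((1 + |y|) ^ (-α)))
    (y : Fin n → ℝ) :
    (∫⁻ τ in Set.Ici b, ∏ i, coordMarginal π0 τ (y i) ∂P) / marginal π0 P y Set.univ ≤
      (∫⁻ τ in Set.Ici b, v τ ^ S.card * ∏ i ∈ Sᶜ, coordRatio π0 τ (y i) ∂P) /
        (P I * (ENNReal.ofReal d ^ S.card * ENNReal.ofReal u ^ Sᶜ.card)) := by
  classical
  set W : ℝ≥0∞ := (∏ i ∈ S, ENNReal.ofReal ((1 + |y i|) ^ (-α))) *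
    ∏ i ∈ Sᶜ, gaussianPDF 0 1 (y i) with hW
  have hW0 : W ≠ 0 := by
    refine mul_ne_zero (Finset.prod_ne_zero_iff.2 fun i _ => ?_)
      (Finset.prod_ne_zero_iff.2 fun i _ => (gaussianPDF_pos 0 one_ne_zero _).ne')
    have : 0 < (1 + |y i|) ^ (-α) := by positivity
    exact (ENNReal.ofReal_pos.2 this).ne'
  have hWt : W ≠ ⊤ := ENNReal.mul_ne_top (ENNReal.prod_ne_top fun i _ => ENNReal.ofReal_ne_top)
    (ENNReal.prod_ne_top fun i _ => gaussianPDF_ne_top)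
  have hden : P I * (ENNReal.ofReal d ^ S.card * ENNReal.ofReal u ^ Sᶜ.card) * W ≤
      marginal π0 P y Set.univ := by
    calc _ = ∫⁻ τ in I, (ENNReal.ofReal d ^ S.card * ENNReal.ofReal u ^ Sᶜ.card) * W ∂P := by
          rw [setLIntegral_const]; ring
      _ ≤ ∫⁻ τ in I, ∏ i, coordMarginal π0 τ (y i) ∂P := by
          refine setLIntegral_mono' hI fun τ hτ => ?_
          rw [← Finset.prod_mul_prod_compl S fun i => coordMarginal π0 τ (y i), hW,
            mul_mul_mul_comm, ← Finset.prod_const, ← Finset.prod_const, ← Finset.prod_mul_distrib,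
            ← Finset.prod_mul_distrib]
          gcongr with i _ i _
          · rw [← ENNReal.ofReal_mul hd.le]
            exact hslab τ hτ _
          · exact hspike τ hτ _
      _ ≤ ∫⁻ τ, ∏ i, coordMarginal π0 τ (y i) ∂P := setLIntegral_le_lintegral _ _
      _ = ∫⁻ τ, marginalGiven π0 τ y Set.univ ∂P := by simp_rw [marginalGiven_univ h]
      _ = _ := rfl
  have hnum : ∫⁻ τ in Set.Ici b, ∏ i, coordMarginal π0 τ (y i) ∂P ≤
      (∫⁻ τ in Set.Ici b, v τ ^ S.card * ∏ i ∈ Sᶜ, coordRatio π0 τ (y i) ∂P) * W := by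
    rw [← lintegral_mul_const' _ _ hWt]
    refine setLIntegral_mono' measurableSet_Ici fun τ hτ => ?_
    rw [← Finset.prod_mul_prod_compl S fun i => coordMarginal π0 τ (y i), hW,
      mul_mul_mul_comm, ← Finset.prod_const, ← Finset.prod_mul_distrib,
      ← Finset.prod_mul_distrib]
    gcongr with i _ i _
    · exact hup τ hτ _
    · rw [coordMarginal_eq, mul_comm]
  calc _ ≤ _ := ENNReal.div_le_div hnum hden
    _ = _ := ENNReal.mul_div_mul_right _ _ hW0 hWt

/-- Off the good event the posterior probability is bounded by 1. Only the remainder R is kept on G,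
because the control of very large τ holds only there. -/
lemma expectedPosterior_le (P : Measure ℝ) (θ' : Fin n → ℝ) {A G : Set (Fin n → ℝ)}
    (hG : MeasurableSet G) {K R : (Fin n → ℝ) → ℝ≥0∞} (hK : Measurable K)
    (hle : ∀ y ∈ G, posteriorProb π0 P y A ≤ K y + R y) :
    expectedPosterior π0 P θ' A ≤
      dataLaw θ' Gᶜ + ∫⁻ y, K y ∂(dataLaw θ') + ∫⁻ y in G, R y ∂(dataLaw θ') := by
  rw [expectedPosterior, ← lintegral_add_compl _ hG, add_comm, add_assoc]
  gcongr
  · calc _ ≤ ∫⁻ y in Gᶜ, 1 ∂(dataLaw θ') := lintegral_mono fun y => posteriorProb_le_one P y A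
      _ = _ := by rw [setLIntegral_one]
  · calc _ ≤ ∫⁻ y in G, (K y + R y) ∂(dataLaw θ') := setLIntegral_mono' hG hle
      _ = ∫⁻ y in G, K y ∂(dataLaw θ') + ∫⁻ y in G, R y ∂(dataLaw θ') := lintegral_add_left hK _
      _ ≤ _ := add_le_add_left (setLIntegral_le_lintegral _ _) _

/-! ### Averages over the data. -/

lemma lintegral_sq_gaussianReal (μ : ℝ) :
    ∫⁻ t, ENNReal.ofReal ((t - μ) ^ 2) ∂(gaussianReal μ 1) = 1 := by
  have h1 : Var[fun x => x; gaussianReal μ 1] = 1 := by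
    simp
  have h2 := ofReal_variance (memLp_id_gaussianReal (μ := μ) (v := 1) 2)
  rw [variance_id_gaussianReal, evariance_eq_lintegral_ofReal] at h2
  simpa [integral_id_gaussianReal] using h2.symm

/-- Markov bound for the residual sum of squares over `S`. -/
lemma dataLaw_sum_sq_gt_le (θ' : Fin n → ℝ) (S : Finset (Fin n)) {r : ℝ} (hr : 0 < r) :
    dataLaw θ' {y | r < ∑ i ∈ S, (y i - θ' i) ^ 2} ≤ ENNReal.ofReal (S.card / r) := by
  have hm : Measurable fun y : Fin n → ℝ => ∑ i ∈ S, ENNReal.ofReal ((y i - θ' i) ^ 2) := by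
    fun_prop
  calc _ ≤ dataLaw θ' {y | ENNReal.ofReal r ≤ ∑ i ∈ S, ENNReal.ofReal ((y i - θ' i) ^ 2)} := by
        refine measure_mono fun y hy => ?_
        rw [Set.mem_ofPred_eq, ← ENNReal.ofReal_sum_of_nonneg fun _ _ => sq_nonneg _]
        exact ENNReal.ofReal_le_ofReal (le_of_lt hy)
    _ ≤ (∫⁻ y, ∑ i ∈ S, ENNReal.ofReal ((y i - θ' i) ^ 2) ∂(dataLaw θ')) / ENNReal.ofReal r :=
        meas_ge_le_lintegral_div hm.aemeasurable (ENNReal.ofReal_pos.2 hr).ne' ENNReal.ofReal_ne_top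
    _ = _ := by
        rw [lintegral_finsetSum _ fun i _ => by fun_prop]
        have e : ∀ i, ∫⁻ y, ENNReal.ofReal ((y i - θ' i) ^ 2) ∂(dataLaw θ') = 1 := fun i =>
          (lintegral_dataLaw_eval θ' i (f := fun t => ENNReal.ofReal ((t - θ' i) ^ 2))
            (by fun_prop)).trans (lintegral_sq_gaussianReal _)
        simp_rw [e]
        rw [ENNReal.ofReal_div_of_pos hr]
        simp

/-- Bound for the posterior moment of a null coordinate: a sharp bound up to the threshold `T`,
and a crude one above it. -/
noncomputable def thresholdBound (A B T y : ℝ) : ℝ≥0∞ :=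
  if |y| ≤ T then ENNReal.ofReal (A * (1 + |y|)) / gaussianPDF 0 1 y
  else ENNReal.ofReal (B * (1 + y ^ 2))

lemma measurable_thresholdBound (A B T : ℝ) : Measurable (thresholdBound A B T) := by
  refine Measurable.ite (measurableSet_le (by fun_prop) measurable_const) ?_ (by fun_prop)
  fun_prop

lemma lintegral_thresholdBound_le {A B T : ℝ} (hA : 0 ≤ A) (hB : 0 ≤ B) (hT : 0 ≤ T) :
    ∫⁻ y, thresholdBound A B T y ∂(gaussianReal 0 1) ≤
      ENNReal.ofReal (2 * A * T * (1 + T) +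
        B * (Real.exp 8 * √(Real.pi / (1 / 8))) * Real.exp (-T ^ 2 / 4)) := by
  rw [gaussianReal_of_var_ne_zero 0 one_ne_zero,
    lintegral_withDensity_eq_lintegral_mul _ (measurable_gaussianPDF _ _)
      (measurable_thresholdBound A B T)]
  have hpt : ∀ y : ℝ, gaussianPDF 0 1 y * thresholdBound A B T y ≤
      (Set.Icc (-T) T).indicator (fun _ => ENNReal.ofReal (A * (1 + T))) y +
      ENNReal.ofReal (B * Real.exp 8 * Real.exp (-T ^ 2 / 4)) *
        ENNReal.ofReal (Real.exp (-(1 / 8) * (0 - y) ^ 2)) := by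
    intro y
    rw [thresholdBound]
    split_ifs with hy
    · refine le_trans ?_ le_self_add
      rw [Set.indicator_of_mem (Set.mem_Icc.2 (abs_le.1 hy)), ENNReal.mul_div_cancel
        (gaussianPDF_pos 0 one_ne_zero y).ne' gaussianPDF_ne_top]
      gcongr
    · refine le_trans ?_ le_add_self
      rw [gaussianPDF, ← ENNReal.ofReal_mul (gaussianPDFReal_nonneg _ _ _),
        ← ENNReal.ofReal_mul (by positivity)]
      apply ENNReal.ofReal_le_ofReal
      -- Spending y²/8 of the Gaussian exponent y²/2 on the polynomial leaves 3y²/8, of which y²/4 ≥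
      -- T²/4 gives the tail factor and y²/8 remains for integration.
      have e1 := one_add_rpow_le_exp (a := 2) (κ := 1 / 8) (by norm_num) (by norm_num) (abs_nonneg y)
      have e2 : 1 + y ^ 2 ≤ Real.exp 8 * Real.exp (1 / 8 * y ^ 2) := by
        rw [sq_abs] at e1
        norm_num at e1
        rw [show (1 : ℝ) / 8 * y ^ 2 = 1 / 8 * y ^ 2 from rfl]
        nlinarith [abs_nonneg y, sq_abs y]
      have e3 : T ^ 2 ≤ y ^ 2 := by
        rw [← sq_abs y]; exact pow_le_pow_left₀ hT (not_le.1 hy).le 2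
      calc gaussianPDFReal 0 1 y * (B * (1 + y ^ 2))
          ≤ Real.exp (-(y - 0) ^ 2 / 2) * (B * (Real.exp 8 * Real.exp (1 / 8 * y ^ 2))) := by
            gcongr
            exact gaussianPDFReal_le_exp 0 y
        _ = B * Real.exp 8 * Real.exp (-(y - 0) ^ 2 / 2 + 1 / 8 * y ^ 2) := by
            rw [Real.exp_add]; ring
        _ ≤ B * Real.exp 8 * Real.exp (-T ^ 2 / 4 + -(1 / 8) * (0 - y) ^ 2) := by
            refine mul_le_mul_of_nonneg_left (Real.exp_le_exp.2 ?_) (by positivity)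
            nlinarith
        _ = _ := by rw [Real.exp_add]; ring
  refine (lintegral_mono hpt).trans ?_
  rw [lintegral_add_left (measurable_const.indicator measurableSet_Icc),
    lintegral_indicator measurableSet_Icc, setLIntegral_const, Real.volume_Icc,
    lintegral_const_mul' _ _ ENNReal.ofReal_ne_top, lintegral_exp_neg_mul_sq_le (by norm_num),
    ← ENNReal.ofReal_mul (by positivity), ← ENNReal.ofReal_mul (by positivity),
    ← ENNReal.ofReal_add (mul_nonneg (by positivity) (by linarith)) (by positivity)]
  apply ENNReal.ofReal_le_ofReal
  apply le_of_eq
  ring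

/-! ### From sums of squares to the two norms. -/

section Geometry

lemma sqrt_sum_add_sq_le {ι : Type*} (S : Finset ι) (a b : ι → ℝ) :
    √(∑ i ∈ S, (a i + b i) ^ 2) ≤ √(∑ i ∈ S, a i ^ 2) + √(∑ i ∈ S, b i ^ 2) := by
  rw [Real.sqrt_le_left (by positivity)]
  have h := Real.sum_mul_le_sqrt_mul_sqrt S a b
  have e : ∑ i ∈ S, (a i + b i) ^ 2 =
      ∑ i ∈ S, a i ^ 2 + 2 * ∑ i ∈ S, a i * b i + ∑ i ∈ S, b i ^ 2 := by
    rw [Finset.mul_sum, ← Finset.sum_add_distrib, ← Finset.sum_add_distrib]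
    exact Finset.sum_congr rfl fun i _ => by ring
  have ha : 0 ≤ ∑ i ∈ S, a i ^ 2 := Finset.sum_nonneg fun _ _ => sq_nonneg _
  have hb : 0 ≤ ∑ i ∈ S, b i ^ 2 := Finset.sum_nonneg fun _ _ => sq_nonneg _
  rw [e, add_sq, Real.sq_sqrt ha, Real.sq_sqrt hb]
  linarith

variable {ω L : ℝ} {θ' y θ : Fin n → ℝ} {S : Finset (Fin n)}

/-- Minkowski's inequality through y: posterior spread around y contributes √(2+ω), observation
noise contributes √(ω/5). -/
lemma sqrt_sum_signal_le (hω : 0 < ω) (hL : 0 < L)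
    (hy : ∑ i ∈ S, (y i - θ' i) ^ 2 ≤ ω / 5 * (S.card * L ^ 2))
    (hS : ∑ i ∈ S, (θ i - y i) ^ 2 < (2 + ω) * (S.card * L ^ 2)) :
    √(∑ i ∈ S, (θ i - θ' i) ^ 2) ≤ (√(2 + ω) + √(ω / 5)) * (√S.card * L) := by
  have hΛ : √(S.card * L ^ 2) = √S.card * L := by
    rw [Real.sqrt_mul (by positivity), Real.sqrt_sq hL.le]
  have h1 : √(∑ i ∈ S, (θ i - y i) ^ 2) ≤ √(2 + ω) * (√S.card * L) := by
    rw [← hΛ, ← Real.sqrt_mul (by positivity)]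
    exact Real.sqrt_le_sqrt hS.le
  have h2 : √(∑ i ∈ S, (y i - θ' i) ^ 2) ≤ √(ω / 5) * (√S.card * L) := by
    rw [← hΛ, ← Real.sqrt_mul (by positivity)]
    exact Real.sqrt_le_sqrt hy
  have h3 := sqrt_sum_add_sq_le S (fun i => θ i - y i) (fun i => y i - θ' i)
  simp only [sub_add_sub_cancel] at h3
  linarith

lemma norm_two_lt (hω : 0 < ω) (hL : 0 < L) (hθ' : ∀ i ∈ Sᶜ, θ' i = 0)
    (hy : ∑ i ∈ S, (y i - θ' i) ^ 2 ≤ ω / 5 * (S.card * L ^ 2))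
    (hS : ∑ i ∈ S, (θ i - y i) ^ 2 < (2 + ω) * (S.card * L ^ 2))
    (hN : ∑ i ∈ Sᶜ, (L * |θ i| + θ i ^ 2) < ω / 5 * (S.card * L ^ 2)) :
    ‖WithLp.toLp 2 (θ - θ')‖ < rateConstTwo ω * √(S.card * L ^ 2) := by
  classical
  have h1 := sqrt_sum_signal_le hω hL hy hS
  have hS0 : 0 ≤ ∑ i ∈ S, (θ i - θ' i) ^ 2 := Finset.sum_nonneg fun _ _ => sq_nonneg _
  rw [Real.sqrt_le_left (by positivity)] at h1
  have h2 : ∑ i ∈ Sᶜ, (θ i - θ' i) ^ 2 ≤ ∑ i ∈ Sᶜ, (L * |θ i| + θ i ^ 2) := by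
    refine Finset.sum_le_sum fun i hi => ?_
    rw [hθ' i hi, sub_zero]
    have : 0 ≤ L * |θ i| := by positivity
    linarith
  rw [rateConstTwo, EuclideanSpace.norm_eq, Real.sqrt_lt' (by
    rcases S.eq_empty_or_nonempty with rfl | hne
    · simp at hS
    · have : 0 < (S.card : ℝ) := by exact_mod_cast hne.card_pos
      positivity)]
  have e : ∑ i, ‖(WithLp.toLp 2 (θ - θ')) i‖ ^ 2 =
      ∑ i ∈ S, (θ i - θ' i) ^ 2 + ∑ i ∈ Sᶜ, (θ i - θ' i) ^ 2 := by
    rw [Finset.sum_add_sum_compl]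
    simp
  have hq : √(ω / 5) ≤ √ω := Real.sqrt_le_sqrt (by linarith)
  have hq2 : √(ω / 5) ^ 2 = ω / 5 := Real.sq_sqrt (by positivity)
  have hr2 : √ω ^ 2 = ω := Real.sq_sqrt hω.le
  have hc : √(S.card : ℝ) ^ 2 = S.card := Real.sq_sqrt (by positivity)
  rw [e, mul_pow _ (√(S.card * L ^ 2)), Real.sq_sqrt (by positivity)]
  rw [mul_pow, mul_pow, hc] at h1
  -- This is where the share ω/5 fits: the two square terms total 2ω/5 ≤ ω, and the cross term grows
  -- since √(ω/5) ≤ √ω.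
  have h3 : (√(2 + ω) + √(ω / 5)) ^ 2 + ω / 5 ≤ (√(2 + ω) + √ω) ^ 2 := by
    have hp : 0 ≤ √(2 + ω) := Real.sqrt_nonneg _
    nlinarith [mul_le_mul_of_nonneg_left hq hp]
  have h4 : 0 ≤ (S.card : ℝ) * L ^ 2 := by positivity
  nlinarith [mul_le_mul_of_nonneg_right h3 h4]

lemma norm_one_lt (hω : 0 < ω) (hL : 0 < L) (hθ' : ∀ i ∈ Sᶜ, θ' i = 0)
    (hy : ∑ i ∈ S, (y i - θ' i) ^ 2 ≤ ω / 5 * (S.card * L ^ 2))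
    (hS : ∑ i ∈ S, (θ i - y i) ^ 2 < (2 + ω) * (S.card * L ^ 2))
    (hN : ∑ i ∈ Sᶜ, (L * |θ i| + θ i ^ 2) < ω / 5 * (S.card * L ^ 2)) :
    ‖WithLp.toLp 1 (θ - θ')‖ < S.card * rateConstOne ω * L := by
  classical
  have h1 := sqrt_sum_signal_le hω hL hy hS
  have hc : √(S.card : ℝ) * √(S.card : ℝ) = S.card := Real.mul_self_sqrt (by positivity)
  have h2 : ∑ i ∈ S, |θ i - θ' i| ≤ √S.card * √(∑ i ∈ S, (θ i - θ' i) ^ 2) := by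
    have := Real.sum_mul_le_sqrt_mul_sqrt S (fun _ => 1) (fun i => |θ i - θ' i|)
    simpa using this
  have h3 : L * ∑ i ∈ Sᶜ, |θ i - θ' i| < ω / 5 * (S.card * L ^ 2) := by
    refine lt_of_le_of_lt ?_ hN
    rw [Finset.mul_sum]
    refine Finset.sum_le_sum fun i hi => ?_
    rw [hθ' i hi, sub_zero]
    linarith [sq_nonneg (θ i)]
  have h3' : ∑ i ∈ Sᶜ, |θ i - θ' i| < ω / 5 * (S.card * L) := by
    refine lt_of_mul_lt_mul_left (h3.trans_eq ?_) hL.le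
    ring
  have e : ‖WithLp.toLp 1 (θ - θ')‖ =
      ∑ i ∈ S, |θ i - θ' i| + ∑ i ∈ Sᶜ, |θ i - θ' i| := by
    rw [Finset.sum_add_sum_compl, PiLp.norm_eq_of_L1]
    simp
  have h4 : √S.card * √(∑ i ∈ S, (θ i - θ' i) ^ 2) ≤
      √S.card * ((√(2 + ω) + √(ω / 5)) * (√S.card * L)) := by gcongr
  have h5 : √(S.card : ℝ) * ((√(2 + ω) + √(ω / 5)) * (√S.card * L)) =
      (√(2 + ω) + √(ω / 5)) * (S.card * L) := by
    calc _ = (√(2 + ω) + √(ω / 5)) * (√S.card * √S.card * L) := by ring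
      _ = _ := by rw [hc]
  -- The nulls contribute at most (ω/5)sL to the ℓ¹ error, which fits under the middle term of the
  -- constant.
  have h6 : ω / 5 ≤ √(ω ^ 2 / 5) := by
    apply Real.le_sqrt_of_sq_le
    nlinarith [sq_nonneg ω]
  have h7 : 0 ≤ (S.card : ℝ) * L := by positivity
  rw [e, rateConstOne]
  nlinarith [mul_le_mul_of_nonneg_right h6 h7]

end Geometry

/-! ### Negligibility of large τ. -/

lemma IsPolyTailDensity.exists_coordMarginal_le_rpow (h : IsPolyTailDensity π0 α)
    (hpole : ∃ β K : ℝ, 0 < β ∧ ∀ x : ℝ, 0 < |x| → |x| ≤ 1 → π0 x ≤ K * |x| ^ (β - 1)) :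
    ∃ C : ℝ, 1 ≤ C ∧ ∀ τ y : ℝ, 0 < τ →
      coordMarginal π0 τ y ≤
        ENNReal.ofReal (C * max 1 τ ^ α) * ENNReal.ofReal ((1 + |y|) ^ (-α)) := by
  obtain ⟨C, hC, hu⟩ := h.exists_lintegral_exp_mul_le hpole (κ := 1 / 2) (by norm_num)
  refine ⟨max 1 C, le_max_left _ _, fun τ y hτ => ?_⟩
  rw [← ENNReal.ofReal_mul (by positivity)]
  calc coordMarginal π0 τ y ≤ ∫⁻ θ, ENNReal.ofReal (Real.exp (-(1 / 2) * (y - θ) ^ 2)) *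
        ENNReal.ofReal (τ⁻¹ * π0 (θ / τ)) := by
        refine lintegral_mono fun θ => ?_
        rw [coordKernel, gaussianPDF]
        gcongr ENNReal.ofReal ?_ * _
        refine (gaussianPDFReal_le_exp θ y).trans (le_of_eq ?_)
        congr 1
        ring
    _ ≤ _ := hu τ y hτ
    _ ≤ _ := by
        gcongr
        exact le_max_right _ _

/-- The moment order must exceed (α-1)/α, so that t^γ = (s/n)^(1+ρ) is small even after summing over
n coordinates, yet stay below 1 and α-1 for integrability. Such a γ exists since α > 1. -/
lemma exists_moment_order (hα : 1 < α) :
    ∃ γ ρ : ℝ, 0 < γ ∧ γ < 1 ∧ γ < α - 1 ∧ 0 < ρ ∧ α / (α - 1) * γ = 1 + ρ := by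
  have hα1 : 0 < α - 1 := by linarith
  have hγex : (α - 1) / α < min 1 (α - 1) := by
    rw [lt_min_iff, div_lt_one (by linarith), div_lt_iff₀ (by linarith)]
    exact ⟨by linarith, by nlinarith⟩
  obtain ⟨γ, hγl, hγu⟩ := exists_between hγex
  refine ⟨γ, α / (α - 1) * γ - 1, lt_trans (by positivity) hγl, hγu.trans_le (min_le_left _ _),
    hγu.trans_le (min_le_right _ _), ?_, by ring⟩
  rw [div_lt_iff₀ (by linarith)] at hγl
  rw [sub_pos, div_mul_eq_mul_div, one_lt_div hα1]
  linarith

lemma exp_neg_two_mul_le {x : ℝ} (hx0 : 0 ≤ x) (hx : x ≤ 1 / 2) :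
    Real.exp (-(2 * x)) ≤ 1 - x := by
  rw [Real.exp_neg, inv_le_comm₀ (Real.exp_pos _) (by linarith)]
  have h1 := Real.add_one_le_exp (2 * x)
  refine le_trans ?_ h1
  rw [inv_le_iff_one_le_mul₀ (by linarith)]
  nlinarith

/-- A deterministic bound: the evidence is flat in y, and dividing by the null density costs √(2π)
exp(y²/2) per coordinate. -/
lemma prod_coordRatio_le {τ β C : ℝ} (hC : 0 < C) (hτ : 0 < τ)
    (hb : ∀ y, coordMarginal π0 τ y ≤ ENNReal.ofReal (C * τ ^ (-β))) (N : Finset (Fin n))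
    (y : Fin n → ℝ) :
    ∏ i ∈ N, coordRatio π0 τ (y i) ≤ ENNReal.ofReal
      ((C * √(2 * Real.pi) * τ ^ (-β)) ^ N.card * Real.exp (∑ i ∈ N, y i ^ 2 / 2)) := by
  have h1 : ∀ t : ℝ, coordRatio π0 τ t ≤
      ENNReal.ofReal (C * √(2 * Real.pi) * τ ^ (-β) * Real.exp (t ^ 2 / 2)) := fun t => by
    have hp := gaussianPDFReal_pos 0 1 t one_ne_zero
    rw [coordRatio, gaussianPDF]
    refine (ENNReal.div_le_div_right (hb t) _).trans (le_of_eq ?_)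
    rw [← ENNReal.ofReal_div_of_pos hp, gaussianPDFReal_one, sub_zero, neg_div, Real.exp_neg]
    congr 1
    have : 0 < √(2 * Real.pi) := by positivity
    field_simp
  calc _ ≤ ∏ i ∈ N, ENNReal.ofReal
        (C * √(2 * Real.pi) * τ ^ (-β) * Real.exp (y i ^ 2 / 2)) :=
        Finset.prod_le_prod' fun i _ => h1 _
    _ = _ := by
        rw [← ENNReal.ofReal_prod_of_nonneg fun _ _ => by positivity, Finset.prod_mul_distrib,
          Finset.prod_const, Real.exp_sum]

/-- The logarithm of a weighted likelihood ratio, with lt = log τ. The s signal factors and the data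
term q/2 each cost at most (β/8) n lt, and the null factors gain (β/4) n lt. -/
lemma sum_log_ratio_nonpos {α β ℓ lt lu lc n s q : ℝ} (hα : 0 < α) (hβ : 0 < β) (hℓ : 0 ≤ ℓ)
    (hs : 0 ≤ s) (hn : 0 ≤ n) (hlt : 4 / β * ℓ ≤ lt) (hu : lu ≤ α * (4 / β) * ℓ)
    (hc : lc ≤ β / 2 * (4 / β) * ℓ) (hs1 : s ≤ 1 / 2 * n) (hs2 : s ≤ β / (16 * α) * n)
    (hq : q ≤ n * ℓ) :
    s * (lu + α * lt) + ((n - s) * (lc + -β * lt) + q / 2) ≤ 0 := by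
  have hlt0 : 0 ≤ lt := le_trans (by positivity) hlt
  have e4 : lu + α * lt ≤ 2 * α * lt := by
    have := mul_le_mul_of_nonneg_left hlt hα.le
    linarith
  have e5 : lc + -β * lt ≤ -(β / 2) * lt := by
    have := mul_le_mul_of_nonneg_left hlt (show 0 ≤ β / 2 by positivity)
    linarith
  have e8 : s * (lu + α * lt) ≤ β / 8 * n * lt := by
    calc s * (lu + α * lt) ≤ s * (2 * α * lt) := by gcongr
      _ ≤ β / (16 * α) * n * (2 * α * lt) := by gcongr
      _ = _ := by field_simp; ring
  have e9 : (n - s) * (lc + -β * lt) ≤ -(β / 4 * n * lt) := by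
    calc _ ≤ (n - s) * (-(β / 2) * lt) := mul_le_mul_of_nonneg_left e5 (by linarith)
      _ = -((n - s) * (β / 2 * lt)) := by ring
      _ ≤ -((1 / 2 * n) * (β / 2 * lt)) := by
          apply neg_le_neg
          gcongr
          linarith
      _ = _ := by ring
  have e10 : n * ℓ / 2 ≤ β / 8 * n * lt := by
    have : ℓ / 2 ≤ β / 8 * lt := by
      calc ℓ / 2 = β / 8 * (4 / β * ℓ) := by field_simp; ring
        _ ≤ _ := by gcongr
    calc n * ℓ / 2 = n * (ℓ / 2) := by ring
      _ ≤ n * (β / 8 * lt) := by gcongr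
      _ = _ := by ring
  linarith

set_option maxHeartbeats 800000 in
/-- The posterior mass of `τ ≥ (s / n) ^ (α / (α - 1))` is negligible; here `s / n = exp (-ℓ)`. -/
lemma IsPolyTailDensity.exists_tail_evidence_le (h : IsPolyTailDensity π0 α)
    (hpole : ∃ β K : ℝ, 0 < β ∧ ∀ x : ℝ, 0 < |x| → |x| ≤ 1 → π0 x ≤ K * |x| ^ (β - 1))
    (ω : ℝ) :
    ∃ M : ℝ, ∀ᶠ ℓ : ℝ in atTop, ∀ (n : ℕ) (S : Finset (Fin n)) (θ' : Fin n → ℝ)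
      (P : Measure ℝ) [IsProbabilityMeasure P], 1 ≤ S.card →
      (S.card : ℝ) = Real.exp (-ℓ) * n → (∀ i ∈ Sᶜ, θ' i = 0) →
      ENNReal.ofReal (Real.exp (-(S.card * ℓ))) ≤
        P (Set.Icc (Real.exp (-ℓ) ^ ((1 + ω / 2) / (α - 1))) (Real.exp (-ℓ) ^ (α / (α - 1)))) →
      P (Set.Ici (Real.exp (-ℓ) ^ (α / (α - 1)))) ≤
        ENNReal.ofReal (Real.exp (-(M * (S.card * ℓ)))) →
      ∫⁻ y in {y : Fin n → ℝ | ∑ i ∈ Sᶜ, y i ^ 2 ≤ n * ℓ},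
        (∫⁻ τ in Set.Ici (Real.exp (-ℓ) ^ (α / (α - 1))), ∏ i, coordMarginal π0 τ (y i) ∂P) /
          marginal π0 P y Set.univ ∂(dataLaw θ') ≤ ENNReal.ofReal (2 * Real.exp (-ℓ)) := by
  have hα := h.one_lt_order
  have hα1 : 0 < α - 1 := by linarith
  obtain ⟨d₀, hd₀, hslab⟩ := h.exists_le_coordMarginal
  obtain ⟨Cu, hCu, hup⟩ := h.exists_coordMarginal_le_rpow hpole
  obtain ⟨β, Cβ, hβ, hCβ, hflat⟩ := h.exists_coordMarginal_le hpole
  obtain ⟨γ, ρ, hγ0, hγ1, hγα, hρ0, hρ⟩ := exists_moment_order hα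
  obtain ⟨Cs, t₀, hCs, ht₀, ht₀1, hspike⟩ := h.exists_gaussian_le_coordMarginal hγ0
    hγ1 hγα
  -- The cutoff is τ = exp(κℓ): beyond it n factors τ^(-β) outweigh exp(nℓ/2), with room for the
  -- signal weights.
  set κ : ℝ := 4 / β with hκ
  have hκ0 : 0 < κ := by positivity
  set C' : ℝ := Cβ * √(2 * Real.pi) with hC'
  have hC'0 : 0 < C' := by positivity
  -- In units of sℓ: κα pays for the weight V, 1 for the prior mass of the interval, 1+ω/2 for the
  -- slab factors d^s. Of the last 2, one absorbs the constant Cu·e/d₀ and one leaves the final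
  -- exp(-ℓ).
  refine ⟨κ * α + 1 + (1 + ω / 2) + 2, ?_⟩
  have lim1 : ∀ a : ℝ, 0 < a → Tendsto (fun ℓ : ℝ => Real.exp (-(a * ℓ))) atTop (𝓝 0) :=
    fun a ha => Real.tendsto_exp_neg_atTop_nhds_zero.comp (tendsto_id.const_mul_atTop ha)
  have lim2 : ∀ a : ℝ, 0 < a → Tendsto (fun ℓ : ℝ => a * ℓ) atTop atTop :=
    fun a ha => tendsto_id.const_mul_atTop ha
  have ev1 : ∀ᶠ ℓ : ℝ in atTop, Real.exp (-(α / (α - 1) * ℓ)) ≤ t₀ :=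
    (lim1 _ (by positivity)).eventually_le_const ht₀
  have ev2 : ∀ᶠ ℓ : ℝ in atTop, Real.exp (-(ρ * ℓ)) ≤ 1 / (2 * Cs) :=
    (lim1 _ hρ0).eventually_le_const (by positivity)
  have ev3 : ∀ᶠ ℓ : ℝ in atTop, Real.log C' ≤ β / 2 * κ * ℓ :=
    (lim2 _ (by positivity)).eventually_ge_atTop _
  have ev4 : ∀ᶠ ℓ : ℝ in atTop, Real.log Cu ≤ α * κ * ℓ :=
    (lim2 _ (by positivity)).eventually_ge_atTop _
  have ev5 : ∀ᶠ ℓ : ℝ in atTop, Real.exp (-(1 * ℓ)) ≤ min (1 / 2) (β / (16 * α)) :=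
    (lim1 _ one_pos).eventually_le_const (by positivity)
  have ev6 : ∀ᶠ ℓ : ℝ in atTop, Cu * Real.exp 1 / d₀ ≤ Real.exp ℓ :=
    Real.tendsto_exp_atTop.eventually_ge_atTop _
  filter_upwards [ev1, ev2, ev3, ev4, ev5, ev6, eventually_ge_atTop 1] with ℓ h1 h2 h3 h4 h5 h6 h7
  intro n S θ' P _ hS hcard hθ' hPI hPT
  have hexp : ∀ x : ℝ, Real.exp (-ℓ) ^ x = Real.exp (-(x * ℓ)) := fun x => by
    rw [← Real.exp_mul]; congr 1; ring
  set t : ℝ := Real.exp (-ℓ) ^ (α / (α - 1)) with ht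
  have ht0 : 0 < t := by positivity
  have htt : t ≤ t₀ := by rw [ht, hexp]; exact h1
  have ht1 : t ≤ 1 := htt.trans ht₀1
  set I : Set ℝ := Set.Icc (Real.exp (-ℓ) ^ ((1 + ω / 2) / (α - 1))) t with hI
  set d : ℝ := d₀ * Real.exp (-((1 + ω / 2) * ℓ)) with hd
  have hd0 : 0 < d := by positivity
  have htγ : t ^ γ = Real.exp (-(ρ * ℓ)) * Real.exp (-ℓ) := by
    rw [ht, ← Real.rpow_mul (Real.exp_pos _).le, hexp, ← Real.exp_add]
    congr 1; rw [hρ]; ring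
  set x : ℝ := Cs * t ^ γ with hx
  have hx0 : 0 ≤ x := by positivity
  have hρs : Cs * Real.exp (-(ρ * ℓ)) ≤ 1 / 2 := by
    rw [le_div_iff₀ (by positivity)] at h2
    linarith
  have hx1 : x ≤ 1 / 2 := by
    have : Real.exp (-ℓ) ≤ 1 := by rw [Real.exp_le_one_iff]; linarith
    calc x = Cs * Real.exp (-(ρ * ℓ)) * Real.exp (-ℓ) := by rw [hx, htγ]; ring
      _ ≤ Cs * Real.exp (-(ρ * ℓ)) := mul_le_of_le_one_right (by positivity) this
      _ ≤ _ := hρs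
  have hn0 : (0 : ℝ) ≤ n := by positivity
  set s : ℕ := S.card with hs
  have hs1 : (1 : ℝ) ≤ s := by exact_mod_cast hS
  have hNcard : (Sᶜ.card : ℝ) = n - s := by
    rw [Finset.card_compl, Fintype.card_fin, Nat.cast_sub (by simpa using S.card_le_univ)]
  -- lower bound for the evidence
  have hslab' : ∀ τ ∈ I, ∀ y, ENNReal.ofReal (d * (1 + |y|) ^ (-α)) ≤ coordMarginal π0 τ y := by
    intro τ hτ y
    have hτ0 : 0 < τ := lt_of_lt_of_le (by positivity) hτ.1
    refine le_trans (ENNReal.ofReal_le_ofReal ?_) (hslab τ y hτ0 (hτ.2.trans ht1))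
    rw [hd]
    gcongr
    calc Real.exp (-((1 + ω / 2) * ℓ))
        = (Real.exp (-ℓ) ^ ((1 + ω / 2) / (α - 1))) ^ (α - 1) := by
          rw [← Real.rpow_mul (Real.exp_pos _).le, div_mul_cancel₀ _ hα1.ne', hexp]
      _ ≤ τ ^ (α - 1) := Real.rpow_le_rpow (by positivity) hτ.1 hα1.le
  have hspike' : ∀ τ ∈ I, ∀ y, ENNReal.ofReal (1 - x) * gaussianPDF 0 1 y ≤
      coordMarginal π0 τ y := by
    intro τ hτ y
    have hτ0 : 0 < τ := lt_of_lt_of_le (by positivity) hτ.1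
    refine le_trans ?_ (hspike τ y hτ0 (hτ.2.trans htt))
    rw [hx]
    gcongr
    exact hτ.2
  have hup' : ∀ τ, t ≤ τ → ∀ y, coordMarginal π0 τ y ≤
      ENNReal.ofReal (Cu * max 1 τ ^ α) * ENNReal.ofReal ((1 + |y|) ^ (-α)) :=
    fun τ hτ y => hup τ y (ht0.trans_le hτ)
  set Z : ℝ≥0∞ := P I * (ENNReal.ofReal d ^ s * ENNReal.ofReal (1 - x) ^ Sᶜ.card) with hZ
  set z : ℝ := Real.exp (-(s * ℓ)) * (d ^ s * Real.exp (-s)) with hz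
  have hz0 : 0 < z := by positivity
  have hzZ : ENNReal.ofReal z ≤ Z := by
    rw [hz, hZ, ENNReal.ofReal_mul (by positivity), ENNReal.ofReal_mul (by positivity),
      ENNReal.ofReal_pow hd0.le]
    gcongr
    rw [← ENNReal.ofReal_pow (by linarith)]
    apply ENNReal.ofReal_le_ofReal
    -- The spike loses only exp(-s) over all nulls: xn = Cs exp(-ρℓ)·s, and Cs exp(-ρℓ) ≤ 1/2.
    calc Real.exp (-s) ≤ Real.exp (-(2 * x)) ^ Sᶜ.card := by
          rw [← Real.exp_nat_mul, Real.exp_le_exp, hNcard]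
          have e1 : x * n ≤ 1 / 2 * s := by
            calc x * n = Cs * Real.exp (-(ρ * ℓ)) * (Real.exp (-ℓ) * n) := by rw [hx, htγ]; ring
              _ ≤ _ := by rw [← hcard]; gcongr
          nlinarith
      _ ≤ _ := by
          gcongr
          exact exp_neg_two_mul_le hx0 hx1
  -- the weighted likelihood ratios
  set Tn : ℝ := Real.exp (κ * ℓ) with hTn
  have hTn1 : 1 ≤ Tn := Real.one_le_exp (by positivity)
  set V : ℝ := (Cu * Tn ^ α) ^ s with hV
  have hV1 : 1 ≤ V := one_le_pow₀ (one_le_mul_of_one_le_of_one_le hCu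
    (Real.one_le_rpow hTn1 (by linarith)))
  have hG : MeasurableSet {y : Fin n → ℝ | ∑ i ∈ Sᶜ, y i ^ 2 ≤ n * ℓ} :=
    measurableSet_le (by fun_prop) measurable_const
  have hw1 : ∀ τ, t ≤ τ → τ ≤ Tn → ENNReal.ofReal (Cu * max 1 τ ^ α) ^ s ≤ ENNReal.ofReal V := by
    intro τ _ hτ
    rw [← ENNReal.ofReal_pow (by positivity)]
    apply ENNReal.ofReal_le_ofReal
    rw [hV]
    gcongr
    exact max_le hTn1 hτ
  have hw2 : ∀ τ, t ≤ τ → Tn < τ → ∀ y ∈ {y : Fin n → ℝ | ∑ i ∈ Sᶜ, y i ^ 2 ≤ n * ℓ},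
      ENNReal.ofReal (Cu * max 1 τ ^ α) ^ s * ∏ i ∈ Sᶜ, coordRatio π0 τ (y i) ≤
        ENNReal.ofReal V := by
    intro τ hτt hτ y hy
    have hτ0 : 0 < τ := ht0.trans_le hτt
    have hlog : κ * ℓ ≤ Real.log τ := (Real.le_log_iff_exp_le hτ0).2 hτ.le
    rw [max_eq_right (hTn1.trans hτ.le)]
    calc _ ≤ ENNReal.ofReal (Cu * τ ^ α) ^ s * ENNReal.ofReal ((C' * τ ^ (-β)) ^ Sᶜ.card *
          Real.exp (∑ i ∈ Sᶜ, y i ^ 2 / 2)) := by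
          gcongr
          exact prod_coordRatio_le hCβ hτ0 (fun y => hflat τ y hτ0) _ _
      _ = ENNReal.ofReal ((Cu * τ ^ α) ^ s * ((C' * τ ^ (-β)) ^ Sᶜ.card *
          Real.exp (∑ i ∈ Sᶜ, y i ^ 2 / 2))) := by
          rw [← ENNReal.ofReal_pow (by positivity), ← ENNReal.ofReal_mul (by positivity)]
      _ ≤ ENNReal.ofReal V := by
          apply ENNReal.ofReal_le_ofReal
          refine le_trans ?_ hV1
          have e1 : Cu * τ ^ α = Real.exp (Real.log Cu + α * Real.log τ) := by
            rw [Real.exp_add, Real.exp_log (by linarith), Real.rpow_def_of_pos hτ0, mul_comm α]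
          have e2 : C' * τ ^ (-β) = Real.exp (Real.log C' + -β * Real.log τ) := by
            rw [Real.exp_add, Real.exp_log hC'0, Real.rpow_def_of_pos hτ0, mul_comm (-β)]
          rw [e1, e2, ← Real.exp_nat_mul, ← Real.exp_nat_mul, ← Real.exp_add, ← Real.exp_add,
            Real.exp_le_one_iff, hNcard, ← Finset.sum_div]
          have e3 : ∑ i ∈ Sᶜ, y i ^ 2 ≤ n * ℓ := hy
          rw [one_mul] at h5
          refine sum_log_ratio_nonpos (by linarith) hβ (by linarith) (by linarith) hn0 hlog h4
            h3 ?_ ?_ e3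
          · rw [hcard]; gcongr; exact h5.trans (min_le_left _ _)
          · rw [hcard]; gcongr; exact h5.trans (min_le_right _ _)
  have hmain := h.lintegral_weighted_ratio_le θ' Sᶜ hθ' P ht0 (T := Tn)
    (V := ENNReal.ofReal V) ENNReal.ofReal_ne_top hG hw1 hw2
  have hZ0 : Z ≠ 0 := (lt_of_lt_of_le (ENNReal.ofReal_pos.2 hz0) hzZ).ne'
  calc _ ≤ ∫⁻ y in {y : Fin n → ℝ | ∑ i ∈ Sᶜ, y i ^ 2 ≤ n * ℓ},
        (∫⁻ τ in Set.Ici t, ENNReal.ofReal (Cu * max 1 τ ^ α) ^ s *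
          ∏ i ∈ Sᶜ, coordRatio π0 τ (y i) ∂P) * Z⁻¹ ∂(dataLaw θ') :=
        lintegral_mono fun y =>
          evidence_ratio_le h.measurable P S hd0 measurableSet_Icc hslab' hspike' hup' y
    _ ≤ 2 * ENNReal.ofReal V * P (Set.Ici t) * Z⁻¹ := by
        rw [lintegral_mul_const' _ _ (ENNReal.inv_ne_top.2 hZ0)]
        gcongr
    _ ≤ 2 * ENNReal.ofReal V *
          ENNReal.ofReal (Real.exp (-((κ * α + 1 + (1 + ω / 2) + 2) * (s * ℓ)))) *
          (ENNReal.ofReal z)⁻¹ := by gcongr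
    _ = ENNReal.ofReal
          (2 * V * Real.exp (-((κ * α + 1 + (1 + ω / 2) + 2) * (s * ℓ))) / z) := by
        rw [ENNReal.ofReal_div_of_pos hz0, ENNReal.ofReal_mul (p := 2 * V) (by positivity),
          ENNReal.ofReal_mul (p := 2) (by norm_num), ENNReal.ofReal_ofNat]
        exact (div_eq_mul_inv _ _).symm
    _ ≤ _ := by
        apply ENNReal.ofReal_le_ofReal
        rw [div_le_iff₀ hz0, mul_assoc, mul_assoc]
        refine mul_le_mul_of_nonneg_left ?_ zero_le_two
        have base : Cu * Tn ^ α * Real.exp (-((κ * α + 1 + (1 + ω / 2) + 2) * ℓ)) ≤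
            Real.exp (-ℓ) * (Real.exp (-ℓ) * (d * Real.exp (-1))) := by
          have e1 : Tn ^ α = Real.exp (κ * α * ℓ) := by
            rw [hTn, ← Real.exp_mul]; congr 1; ring
          have e2 : Cu ≤ d₀ * Real.exp (-1) * Real.exp ℓ := by
            rw [div_le_iff₀ hd₀] at h6
            rw [Real.exp_neg, mul_assoc, mul_left_comm, ← div_eq_inv_mul, le_div_iff₀ (Real.exp_pos _)]
            linarith
          calc _ ≤ d₀ * Real.exp (-1) * Real.exp ℓ * Real.exp (κ * α * ℓ) *
                Real.exp (-((κ * α + 1 + (1 + ω / 2) + 2) * ℓ)) := by rw [e1]; gcongr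
            _ = d₀ * Real.exp (-1 + ℓ + κ * α * ℓ + -((κ * α + 1 + (1 + ω / 2) + 2) * ℓ)) := by
                rw [Real.exp_add, Real.exp_add, Real.exp_add]; ring
            _ = d₀ * Real.exp (-ℓ + -ℓ + -((1 + ω / 2) * ℓ) + -1) := by
                congr 2; ring
            _ = _ := by
                rw [Real.exp_add, Real.exp_add, Real.exp_add, hd]; ring
        calc V * Real.exp (-((κ * α + 1 + (1 + ω / 2) + 2) * (s * ℓ)))
            = (Cu * Tn ^ α * Real.exp (-((κ * α + 1 + (1 + ω / 2) + 2) * ℓ))) ^ s := by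
              rw [mul_pow, ← Real.exp_nat_mul, hV]; congr 2; ring
          _ ≤ (Real.exp (-ℓ) * (Real.exp (-ℓ) * (d * Real.exp (-1)))) ^ s := by gcongr
          _ = Real.exp (-ℓ) ^ s * z := by
              rw [mul_pow, mul_pow, mul_pow, hz, ← Real.exp_nat_mul (-1), ← Real.exp_nat_mul (-ℓ)]
              congr 4
              · ring
              · ring
          _ ≤ _ := by
              gcongr
              exact pow_le_of_le_one (Real.exp_pos _).le
                (by rw [Real.exp_le_one_iff]; linarith) (by omega)

/-! ### Null coordinates. -/

lemma tendsto_exp_neg_const_mul {a : ℝ} (ha : 0 < a) :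
    Tendsto (fun ℓ : ℝ => Real.exp (-(a * ℓ))) atTop (𝓝 0) :=
  Real.tendsto_exp_neg_atTop_nhds_zero.comp (tendsto_id.const_mul_atTop ha)

lemma tendsto_mul_exp_neg_const_mul {a : ℝ} (ha : 0 < a) :
    Tendsto (fun ℓ : ℝ => ℓ * Real.exp (-(a * ℓ))) atTop (𝓝 0) := by
  have h := ((Real.tendsto_pow_mul_exp_neg_atTop_nhds_zero 1).comp
    (tendsto_id.const_mul_atTop ha)).const_mul a⁻¹
  rw [mul_zero] at h
  refine h.congr fun ℓ => ?_
  simp only [Function.comp, id, pow_one]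
  field_simp

/-- Posterior moments of a null coordinate are negligible, uniformly in the relevant `τ`. -/
lemma IsPolyTailDensity.exists_null_bound (h : IsPolyTailDensity π0 α)
    (hpole : ∃ β K : ℝ, 0 < β ∧ ∀ x : ℝ, 0 < |x| → |x| ≤ 1 → π0 x ≤ K * |x| ^ (β - 1))
    {c : ℝ} (hc : 0 ≤ c) :
    ∃ err : ℝ → ℝ, Tendsto err atTop (𝓝 0) ∧ ∀ᶠ ℓ : ℝ in atTop, ∀ L : ℝ, 1 ≤ L →
      ∃ b : ℝ → ℝ≥0∞, Measurable b ∧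
        (∀ τ, 0 < τ → τ ≤ Real.exp (-ℓ) ^ (α / (α - 1)) →
          τ ^ (-(α - 1)) ≤ Real.exp (c * L ^ 2) → ∀ y,
          ∫⁻ θ, ENNReal.ofReal (L * |θ| + θ ^ 2) * coordKernel π0 τ y θ ≤
            b y * coordMarginal π0 τ y) ∧
        ∫⁻ y, b y ∂(gaussianReal 0 1) ≤ ENNReal.ofReal (L ^ 2 * Real.exp (-ℓ) * err ℓ) := by
  have hα := h.one_lt_order
  have hα1 : 0 < α - 1 := by linarith
  obtain ⟨γ, ρ, hγ0, hγ1, hγα, hρ0, hρ⟩ := exists_moment_order hα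
  obtain ⟨Cs, t₀, hCs, ht₀, ht₀1, hspike⟩ := h.exists_gaussian_le_coordMarginal hγ0 hγ1 hγα
  obtain ⟨Cm, hCm, hmom⟩ := h.exists_lintegral_moment_le hpole hγ0 hγ1 hγα
  obtain ⟨Cl, hCl, hcrude⟩ := h.exists_lintegral_moment_le_log hpole hc
  set C₀ : ℝ := Real.exp 8 * √(Real.pi / (1 / 8)) with hC₀
  refine ⟨fun ℓ => 64 * Cm * (ℓ * Real.exp (-(ρ * ℓ))) + Cl * C₀ * Real.exp (-(1 * ℓ)), ?_, ?_⟩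
  · simpa using ((tendsto_mul_exp_neg_const_mul hρ0).const_mul (64 * Cm)).add
      ((tendsto_exp_neg_const_mul one_pos).const_mul (Cl * C₀))
  have ev1 : ∀ᶠ ℓ : ℝ in atTop, Real.exp (-(α / (α - 1) * ℓ)) ≤ t₀ :=
    (tendsto_exp_neg_const_mul (by positivity)).eventually_le_const ht₀
  have ev2 : ∀ᶠ ℓ : ℝ in atTop, Real.exp (-((1 + ρ) * ℓ)) ≤ 1 / (2 * Cs) :=
    (tendsto_exp_neg_const_mul (by positivity)).eventually_le_const (by positivity)
  filter_upwards [ev1, ev2, eventually_ge_atTop 1] with ℓ h1 h2 h3 L hL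
  set t : ℝ := Real.exp (-ℓ) ^ (α / (α - 1)) with ht
  have ht0 : 0 < t := by positivity
  have hexp : ∀ x : ℝ, Real.exp (-ℓ) ^ x = Real.exp (-(x * ℓ)) := fun x => by
    rw [← Real.exp_mul]; congr 1; ring
  have htt : t ≤ t₀ := by rw [ht, hexp]; exact h1
  have htγ : t ^ γ = Real.exp (-((1 + ρ) * ℓ)) := by
    rw [ht, ← Real.rpow_mul (Real.exp_pos _).le, hexp, hρ]
  -- Makes exp(-T²/4) = (s/n)², so the crude bound above T is negligible against s/n; below T the
  -- price is only T(1+T) = O(ℓ), which (s/n)^ρ absorbs.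
  set T : ℝ := √(8 * ℓ) with hT
  have hT2 : T ^ 2 = 8 * ℓ := Real.sq_sqrt (by linarith)
  have hT1 : 1 ≤ T := by rw [hT, Real.one_le_sqrt]; linarith
  refine ⟨thresholdBound (2 * (Cm * L * t ^ γ)) (Cl * L ^ 2) T, measurable_thresholdBound _ _ _,
    fun τ hτ hτt hτL y => ?_, ?_⟩
  · rw [thresholdBound]
    split_ifs with hy
    · have hτγ : τ ^ γ ≤ t ^ γ := Real.rpow_le_rpow hτ.le hτt hγ0.le
      have hhalf : ENNReal.ofReal (1 / 2) * gaussianPDF 0 1 y ≤ coordMarginal π0 τ y := by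
        refine le_trans ?_ (hspike τ y hτ (hτt.trans htt))
        gcongr
        have : Cs * τ ^ γ ≤ Cs * (1 / (2 * Cs)) := by
          gcongr
          exact hτγ.trans (htγ ▸ h2)
        have e : Cs * (1 / (2 * Cs)) = 1 / 2 := by field_simp
        linarith
      have hcancel : ∀ X : ℝ≥0∞, X / gaussianPDF 0 1 y *
          (ENNReal.ofReal (1 / 2) * gaussianPDF 0 1 y) = X * ENNReal.ofReal (1 / 2) := fun X => by
        rw [mul_left_comm, ENNReal.div_mul_cancel (gaussianPDF_pos 0 one_ne_zero y).ne'
          gaussianPDF_ne_top, mul_comm]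
      calc _ ≤ ENNReal.ofReal (Cm * L * τ ^ γ * (1 + |y|)) := hmom L τ y hL hτ
        _ ≤ ENNReal.ofReal (2 * (Cm * L * t ^ γ) * (1 + |y|) * (1 / 2)) := by
            apply ENNReal.ofReal_le_ofReal
            calc _ ≤ Cm * L * t ^ γ * (1 + |y|) := by gcongr
              _ = _ := by ring
        _ = ENNReal.ofReal (2 * (Cm * L * t ^ γ) * (1 + |y|)) / gaussianPDF 0 1 y *
              (ENNReal.ofReal (1 / 2) * gaussianPDF 0 1 y) := by
            rw [hcancel, ← ENNReal.ofReal_mul (by positivity)]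
        _ ≤ _ := by gcongr
    · exact hcrude L τ y hL hτ (hτt.trans (htt.trans ht₀1)) hτL
  · refine (lintegral_thresholdBound_le (by positivity) (by positivity) (by positivity)).trans ?_
    apply ENNReal.ofReal_le_ofReal
    have e1 : Real.exp (-T ^ 2 / 4) = Real.exp (-ℓ) * Real.exp (-ℓ) := by
      rw [hT2, ← Real.exp_add]; congr 1; ring
    have e2 : t ^ γ = Real.exp (-(ρ * ℓ)) * Real.exp (-ℓ) := by
      rw [htγ, ← Real.exp_add]; congr 1; ring
    have e3 : T * (1 + T) ≤ 16 * ℓ := by nlinarith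
    rw [e1, one_mul, ← hC₀]
    calc _ = 4 * Cm * L * t ^ γ * (T * (1 + T)) +
          Cl * L ^ 2 * C₀ * (Real.exp (-ℓ) * Real.exp (-ℓ)) := by ring
      _ ≤ 4 * Cm * L ^ 2 * t ^ γ * (16 * ℓ) +
          Cl * L ^ 2 * C₀ * (Real.exp (-ℓ) * Real.exp (-ℓ)) := by
          gcongr
          nlinarith
      _ = _ := by rw [e2]; ring

/-! ### Assembly of the uniform bound. -/

lemma dataLaw_compl_le (θ' : Fin n → ℝ) (S : Finset (Fin n)) (hθ' : ∀ i ∈ Sᶜ, θ' i = 0)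
    {r q : ℝ} (hr : 0 < r) (hq : 0 < q) :
    dataLaw θ' ({y | ∑ i ∈ S, (y i - θ' i) ^ 2 ≤ r} ∩ {y | ∑ i ∈ Sᶜ, y i ^ 2 ≤ q})ᶜ ≤
      ENNReal.ofReal (S.card / r) + ENNReal.ofReal (n / q) := by
  rw [Set.compl_inter]
  refine (measure_union_le _ _).trans (add_le_add ?_ ?_)
  · refine (measure_mono fun y hy => ?_).trans (dataLaw_sum_sq_gt_le θ' S hr)
    change r < ∑ i ∈ S, (y i - θ' i) ^ 2
    exact not_le.1 hy
  · refine (measure_mono fun y hy => ?_).trans ((dataLaw_sum_sq_gt_le θ' Sᶜ hq).trans ?_)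
    · have e : ∑ i ∈ Sᶜ, (y i - θ' i) ^ 2 = ∑ i ∈ Sᶜ, y i ^ 2 :=
        Finset.sum_congr rfl fun i hi => by rw [hθ' i hi, sub_zero]
      change q < ∑ i ∈ Sᶜ, (y i - θ' i) ^ 2
      rw [e]
      exact not_le.1 hy
    · gcongr
      simpa using Sᶜ.card_le_univ

set_option maxHeartbeats 800000 in
/-- Non-asymptotic form of the contraction result; here `s / n = exp (-ℓ)`. -/
lemma IsPolyTailDensity.exists_expectedPosterior_le (h : IsPolyTailDensity π0 α)
    (hpole : ∃ β K : ℝ, 0 < β ∧ ∀ x : ℝ, 0 < |x| → |x| ≤ 1 → π0 x ≤ K * |x| ^ (β - 1))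
    {ω c : ℝ} (hω : 0 < ω) (hc : c < 1 + ω / 2) :
    ∃ (M : ℝ) (err : ℝ → ℝ), Tendsto err atTop (𝓝 0) ∧ ∀ᶠ ℓ : ℝ in atTop,
      ∀ (n : ℕ) (S : Finset (Fin n)) (θ' : Fin n → ℝ) (P : Measure ℝ) [IsProbabilityMeasure P],
      1 ≤ S.card → (S.card : ℝ) = Real.exp (-ℓ) * n → (∀ i ∈ Sᶜ, θ' i = 0) →
      P (Set.Iio ((1 / (n : ℝ)) ^ (c / (α - 1)))) = 0 →
      ENNReal.ofReal (Real.exp (-(S.card * ℓ))) ≤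
        P (Set.Icc (Real.exp (-ℓ) ^ ((1 + ω / 2) / (α - 1))) (Real.exp (-ℓ) ^ (α / (α - 1)))) →
      P (Set.Ici (Real.exp (-ℓ) ^ (α / (α - 1)))) ≤
        ENNReal.ofReal (Real.exp (-(M * (S.card * ℓ)))) →
      ∀ A : Set (Fin n → ℝ),
      (∀ y θ : Fin n → ℝ, ∑ i ∈ S, (y i - θ' i) ^ 2 ≤ ω / 5 * (S.card * √(Real.log n) ^ 2) → θ ∈ A →
        (2 + ω) * (S.card * √(Real.log n) ^ 2) ≤ ∑ i ∈ S, (θ i - y i) ^ 2 ∨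
        ω / 5 * (S.card * √(Real.log n) ^ 2) ≤
          ∑ i ∈ Sᶜ, (√(Real.log n) * |θ i| + θ i ^ 2)) →
      expectedPosterior π0 P θ' A ≤ ENNReal.ofReal (err ℓ) := by
  have hα := h.one_lt_order
  have hα1 : 0 < α - 1 := by linarith
  -- For negative c the bound n^c is replaced by 1, since the moment lemmas and l ≥ 0 need a
  -- nonnegative exponent.
  set c' : ℝ := max c 0 with hc'
  have hc'0 : 0 ≤ c' := le_max_right _ _
  have hc'1 : c' < 1 + ω / 2 := max_lt hc (by linarith)
  -- Half of the gap goes into l, so that l(1+ω/2) = c'+δ with l < 1; the Chernoff factor per signal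
  -- is then Q n^(c') n^(-(c'+δ)) = Q n^(-δ).
  set δ : ℝ := (1 + ω / 2 - c') / 2 with hδ
  have hδ0 : 0 < δ := by rw [hδ]; linarith
  set l : ℝ := (c' + δ) / (1 + ω / 2) with hl
  have hl0 : 0 ≤ l := by positivity
  have hl1 : l < 1 := by rw [hl, div_lt_one (by positivity), hδ]; linarith
  obtain ⟨M, hM⟩ := h.exists_tail_evidence_le hpole ω
  obtain ⟨err₀, herr₀, hnull⟩ := h.exists_null_bound hpole hc'0
  obtain ⟨Q, hQ, hexpm⟩ := h.exists_lintegral_exp_sq_le hpole hl1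
  -- The terms account for noise on S, noise on the nulls, the two posterior events for moderate τ,
  -- and the posterior mass of large τ.
  refine ⟨M, fun ℓ => 5 / ω * ℓ⁻¹ + ℓ⁻¹ + (Q * Real.exp (-(δ * ℓ)) + 5 / ω * max (err₀ ℓ) 0) +
    2 * Real.exp (-(1 * ℓ)), ?_, ?_⟩
  · have i1 : Tendsto (fun ℓ : ℝ => ℓ⁻¹) atTop (𝓝 0) := tendsto_inv_atTop_zero
    have i2 := (tendsto_exp_neg_const_mul hδ0).const_mul Q
    have i3 := (herr₀.max (tendsto_const_nhds (x := (0 : ℝ)))).const_mul (5 / ω)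
    have i4 := (tendsto_exp_neg_const_mul one_pos).const_mul 2
    simpa using (((i1.const_mul (5 / ω)).add i1).add (i2.add i3)).add i4
  -- With base at most 1, the s-th power is at most the first power, so the bound does not depend on
  -- s.
  have ev1 : ∀ᶠ ℓ : ℝ in atTop, Q * Real.exp (-(δ * ℓ)) ≤ 1 := by
    have := (tendsto_exp_neg_const_mul hδ0).const_mul Q
    rw [mul_zero] at this
    exact this.eventually_le_const one_pos
  filter_upwards [hM, hnull, ev1, eventually_ge_atTop 1] with ℓ hM hnull hQℓ hℓ
  intro n S θ' P _ hS hcard hθ' hsupp hPI hPT A hA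
  set s : ℕ := S.card with hs
  have hs1 : (1 : ℝ) ≤ s := by exact_mod_cast hS
  have hn : (n : ℝ) = s * Real.exp ℓ := by
    rw [hcard, mul_right_comm, ← Real.exp_add]; simp
  have hnℓ : Real.exp ℓ ≤ n := by
    rw [hn]; exact le_mul_of_one_le_left (Real.exp_pos _).le hs1
  clear hn
  have hn0 : (0 : ℝ) < n := (Real.exp_pos _).trans_le hnℓ
  have hlogn : ℓ ≤ Real.log n := (Real.le_log_iff_exp_le hn0).2 hnℓ
  set L : ℝ := √(Real.log n) with hLdef
  have hL2 : L ^ 2 = Real.log n := Real.sq_sqrt (by linarith)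
  have hL1 : 1 ≤ L := by rw [hLdef, Real.one_le_sqrt]; linarith
  obtain ⟨b, hbm, hb, hbint⟩ := hnull L hL1
  set t : ℝ := Real.exp (-ℓ) ^ (α / (α - 1)) with ht
  have ht1 : t ≤ 1 :=
    Real.rpow_le_one (Real.exp_pos _).le (by rw [Real.exp_le_one_iff]; linarith)
      (by positivity)
  set a : ℝ := (1 / (n : ℝ)) ^ (c / (α - 1)) with ha
  have ha0 : 0 < a := by positivity
  have haτ : ∀ τ, a ≤ τ → τ ^ (-(α - 1)) ≤ Real.exp (c' * L ^ 2) := by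
    intro τ hτ
    calc τ ^ (-(α - 1)) ≤ a ^ (-(α - 1)) :=
          Real.rpow_le_rpow_of_nonpos ha0 hτ (by linarith)
      _ = (n : ℝ) ^ c := by
          rw [ha, ← Real.rpow_mul (by positivity), one_div, Real.inv_rpow hn0.le,
            ← Real.rpow_neg hn0.le]
          congr 1
          field_simp
      _ ≤ (n : ℝ) ^ c' := by
          refine Real.rpow_le_rpow_of_exponent_le ?_ (le_max_left _ _)
          exact (Real.one_le_exp (by linarith)).trans hnℓ
      _ = _ := by rw [Real.rpow_def_of_pos hn0, hL2, mul_comm]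
  set Λ : ℝ := s * L ^ 2 with hΛ
  have hΛ0 : 0 < Λ := by positivity
  set q : ℝ := Q * Real.exp (c' * L ^ 2) with hq
  set kS : ℝ := Real.exp (-(l / 2 * ((2 + ω) * Λ))) * q ^ s with hkS
  set K : (Fin n → ℝ) → ℝ≥0∞ := fun y =>
    ENNReal.ofReal kS + ENNReal.ofReal (ω / 5 * Λ)⁻¹ * ∑ i ∈ Sᶜ, b (y i) with hK
  have hbm' : ∀ i : Fin n, Measurable fun y : Fin n → ℝ => b (y i) :=
    fun i => hbm.comp (measurable_pi_apply i)
  have hKm : Measurable K := by fun_prop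
  set G : Set (Fin n → ℝ) := {y | ∑ i ∈ S, (y i - θ' i) ^ 2 ≤ ω / 5 * Λ} ∩
    {y | ∑ i ∈ Sᶜ, y i ^ 2 ≤ n * ℓ} with hG
  have hGm : MeasurableSet G :=
    (measurableSet_le (by fun_prop) measurable_const).inter
      (measurableSet_le (by fun_prop) measurable_const)
  have hpost : ∀ y ∈ G, posteriorProb π0 P y A ≤ K y +
      (∫⁻ τ in Set.Ici t, ∏ i, coordMarginal π0 τ (y i) ∂P) / marginal π0 P y Set.univ := by
    intro y hy
    refine posteriorProb_le h.measurable hsupp fun τ hτa hτt => ?_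
    have hτ0 : 0 < τ := ha0.trans_le hτa
    have hsub : A ⊆ {θ | (2 + ω) * Λ ≤ ∑ i ∈ S, (θ i - y i) ^ 2} ∪
        {θ | ω / 5 * Λ ≤ ∑ i ∈ Sᶜ, (fun t => L * |t| + t ^ 2) (θ i)} :=
      fun θ hθ => hA y θ hy.1 hθ
    have b1 := marginalGiven_sq_le h.measurable S (R := (2 + ω) * Λ) hl0 (q := q) (by positivity)
      (τ := τ) (fun y => (hexpm τ y hτ0 (hτt.le.trans ht1)).trans (by
        rw [hq]
        gcongr
        exact haτ τ hτa)) y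
    have b2 := marginalGiven_sum_le h.measurable Sᶜ (Δ := ω / 5 * Λ) (τ := τ) (b := b)
      (ψ := fun t => L * |t| + t ^ 2) (by fun_prop) (fun t => by positivity) (by positivity)
      (hb τ hτ0 hτt.le (haτ τ hτa)) y
    calc _ ≤ _ := lintegral_mono_set hsub
      _ ≤ _ := lintegral_union_le _ _ _
      _ ≤ _ := add_le_add b1 b2
      _ = _ := by rw [← add_mul]
  have htail := hM n S θ' P hS hcard hθ' hPI hPT
  have hKint : ∫⁻ y, K y ∂(dataLaw θ') ≤
      ENNReal.ofReal (Q * Real.exp (-(δ * ℓ)) + 5 / ω * max (err₀ ℓ) 0) := by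
    have hbi : ∀ i ∈ Sᶜ, ∫⁻ y, b (y i) ∂(dataLaw θ') ≤
        ENNReal.ofReal (L ^ 2 * Real.exp (-ℓ) * max (err₀ ℓ) 0) := by
      intro i hi
      rw [lintegral_dataLaw_eval θ' i hbm, hθ' i hi]
      refine hbint.trans (ENNReal.ofReal_le_ofReal ?_)
      gcongr
      exact le_max_left _ _
    have hm0 : 0 ≤ max (err₀ ℓ) 0 := le_max_right _ _
    rw [hK, lintegral_add_left measurable_const, lintegral_const, measure_univ, mul_one,
      lintegral_const_mul' _ _ ENNReal.ofReal_ne_top,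
      lintegral_finsetSum _ fun i _ => hbm' i,
      ENNReal.ofReal_add (by positivity) (by positivity)]
    gcongr ?_ + ?_
    · apply ENNReal.ofReal_le_ofReal
      have e1 : kS = (Q * Real.exp (-(δ * L ^ 2))) ^ s := by
        have e2 : l / 2 * ((2 + ω) * Λ) = s * ((c' + δ) * L ^ 2) := by
          rw [hl, hΛ]; field_simp
        rw [hkS, e2, hq, ← mul_neg, Real.exp_nat_mul, ← mul_pow, mul_left_comm, ← Real.exp_add]
        congr 3; ring
      have e3 : Real.exp (-(δ * L ^ 2)) ≤ Real.exp (-(δ * ℓ)) := by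
        rw [Real.exp_le_exp, hL2]; nlinarith
      calc kS = (Q * Real.exp (-(δ * L ^ 2))) ^ s := e1
        _ ≤ (Q * Real.exp (-(δ * ℓ))) ^ s := by gcongr
        _ ≤ _ := pow_le_of_le_one (by positivity) hQℓ (by omega)
    · calc _ ≤ ENNReal.ofReal (ω / 5 * Λ)⁻¹ * ∑ i ∈ Sᶜ,
            ENNReal.ofReal (L ^ 2 * Real.exp (-ℓ) * max (err₀ ℓ) 0) := by
            gcongr with i hi
            exact hbi i hi
        _ = ENNReal.ofReal ((ω / 5 * Λ)⁻¹ *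
            (Sᶜ.card * (L ^ 2 * Real.exp (-ℓ) * max (err₀ ℓ) 0))) := by
            rw [Finset.sum_const, nsmul_eq_mul,
              ENNReal.ofReal_mul (p := (ω / 5 * Λ)⁻¹) (by positivity),
              ENNReal.ofReal_mul (p := (Sᶜ.card : ℝ)) (by positivity), ENNReal.ofReal_natCast]
        _ ≤ _ := by
            apply ENNReal.ofReal_le_ofReal
            have hN : (Sᶜ.card : ℝ) ≤ n := by
              have := Sᶜ.card_le_univ
              rw [Fintype.card_fin] at this
              exact_mod_cast this
            calc _ ≤ (ω / 5 * Λ)⁻¹ * (n * (L ^ 2 * Real.exp (-ℓ) * max (err₀ ℓ) 0)) := by gcongr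
              _ = (ω / 5 * Λ)⁻¹ * ((Real.exp (-ℓ) * n) * L ^ 2 * max (err₀ ℓ) 0) := by ring
              _ = _ := by rw [← hcard, ← hΛ]; field_simp
  have hGc := dataLaw_compl_le θ' S hθ' (r := ω / 5 * Λ) (q := n * ℓ) (by positivity) (by positivity)
  calc expectedPosterior π0 P θ' A ≤ _ := expectedPosterior_le P θ' hGm hKm hpost
    _ ≤ (ENNReal.ofReal (5 / ω * ℓ⁻¹) + ENNReal.ofReal ℓ⁻¹) +
          ENNReal.ofReal (Q * Real.exp (-(δ * ℓ)) + 5 / ω * max (err₀ ℓ) 0) +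
          ENNReal.ofReal (2 * Real.exp (-(1 * ℓ))) := by
        refine add_le_add (add_le_add (hGc.trans (add_le_add ?_ ?_)) hKint) ?_
        · apply ENNReal.ofReal_le_ofReal
          calc (s : ℝ) / (ω / 5 * Λ) = 5 / ω * (L ^ 2)⁻¹ := by rw [hΛ]; field_simp
            _ ≤ _ := by
                gcongr
                rw [hL2]; exact hlogn
        · apply ENNReal.ofReal_le_ofReal
          apply le_of_eq
          field_simp
        · refine (lintegral_mono' (Measure.restrict_mono Set.inter_subset_right le_rfl)
            le_rfl).trans ?_
          rw [one_mul]
          exact htail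
    _ = _ := by
        have hm0 : 0 ≤ max (err₀ ℓ) 0 := le_max_right _ _
        rw [← ENNReal.ofReal_add (by positivity) (by positivity),
          ← ENNReal.ofReal_add (by positivity) (by positivity),
          ← ENNReal.ofReal_add (by positivity) (by positivity)]

/-! ### From the limit hypotheses to exponential bounds, and the conclusion. -/

lemma ofReal_exp_le_of_negLog_div_lt {p : ℝ≥0∞} {b x : ℝ} (hb : 0 < b)
    (h : negLog p / (b : EReal) < (x : EReal)) : ENNReal.ofReal (Real.exp (-(x * b))) ≤ p := by
  rw [EReal.div_lt_iff (by exact_mod_cast hb) (EReal.coe_ne_top _), negLog, EReal.neg_lt_comm,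
    ← EReal.coe_mul, ← EReal.coe_neg] at h
  rw [← ENNReal.log_le_log_iff, ENNReal.log_ofReal_of_pos (Real.exp_pos _), Real.log_exp]
  exact h.le

lemma le_ofReal_exp_of_lt_negLog_div {p : ℝ≥0∞} {b x : ℝ} (hb : 0 < b)
    (h : (x : EReal) < negLog p / (b : EReal)) : p ≤ ENNReal.ofReal (Real.exp (-(x * b))) := by
  rw [EReal.lt_div_iff (by exact_mod_cast hb) (EReal.coe_ne_top _), negLog, EReal.lt_neg_comm,
    ← EReal.coe_mul, ← EReal.coe_neg] at h
  rw [← ENNReal.log_le_log_iff, ENNReal.log_ofReal_of_pos (Real.exp_pos _), Real.log_exp]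
  exact h.le

end SparseMeans

theorem theorem4
    (π0 : ℝ → ℝ) (α ω c : ℝ) (hω : 0 < ω)
    (hπ0 : SparseMeans.IsPolyTailDensity π0 α)
    -- any singularity of the prior density at the origin is at most of power type
    (hpole : ∃ β K : ℝ, 0 < β ∧ ∀ x : ℝ, 0 < |x| → |x| ≤ 1 → π0 x ≤ K * |x| ^ (β - 1))
    (hα : α ≤ 1 + ω / 2) (hc : c < 1 + ω / 2)
    -- sparsity: the true mean has exactly `s n` nonzero entries, `s n ≥ 1`, `s = o(n)`
    (s : ℕ → ℕ) (hs_pos : ∀ᶠ n in atTop, 1 ≤ s n)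
    (hs : Tendsto (fun n : ℕ => (s n : ℝ) / n) atTop (𝓝 0))
    (θstar : (n : ℕ) → Fin n → ℝ)
    (hθstar : ∀ n, {i : Fin n | θstar n i ≠ 0}.ncard = s n)
    -- the hyperprior on the global shrinkage parameter
    (P : ℕ → Measure ℝ) (hP : ∀ n, IsProbabilityMeasure (P n))
    (hsupp : ∀ᶠ n : ℕ in atTop, P n (Set.Iio ((1 / (n : ℝ)) ^ (c / (α - 1)))) = 0)
    (hmass : SparseMeans.AsympBelow
      (fun n => SparseMeans.negLog
        (P n (Set.Icc (((s n : ℝ) / n) ^ ((1 + ω / 2) / (α - 1)))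
          (((s n : ℝ) / n) ^ (α / (α - 1))))))
      (fun n => s n * Real.log ((n : ℝ) / s n)))
    (htail : SparseMeans.AsympAbove
      (fun n => SparseMeans.negLog
        (P n (Set.Ici (((s n : ℝ) / n) ^ (α / (α - 1))))))
      (fun n => s n * Real.log ((n : ℝ) / s n))) :
    Tendsto (fun n => SparseMeans.expectedPosterior π0 (P n) (θstar n)
        {θ | SparseMeans.rateConstTwo ω * √(s n * Real.log n)
          ≤ ‖WithLp.toLp 2 (θ - θstar n)‖}) atTop (𝓝 0) ∧
    Tendsto (fun n => SparseMeans.expectedPosterior π0 (P n) (θstar n)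
        {θ | s n * SparseMeans.rateConstOne ω * √(Real.log n)
          ≤ ‖WithLp.toLp 1 (θ - θstar n)‖}) atTop (𝓝 0) := by
  classical
  obtain ⟨M, err, herr, hmain⟩ := hπ0.exists_expectedPosterior_le hpole hω hc
  set S : (n : ℕ) → Finset (Fin n) := fun n => Finset.univ.filter fun i => θstar n i ≠ 0 with hS
  have hcard : ∀ n, (S n).card = s n := fun n => by
    rw [← hθstar n, Set.ncard_eq_toFinset_card']
    congr 1
    ext i
    simp [hS]
  have hzero : ∀ n, ∀ i ∈ (S n)ᶜ, θstar n i = 0 := fun n i hi => by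
    simpa [hS] using hi
  set ℓ : ℕ → ℝ := fun n => Real.log ((n : ℝ) / s n) with hℓ
  have hpos : ∀ᶠ n : ℕ in atTop, (0 : ℝ) < s n ∧ (0 : ℝ) < n := by
    filter_upwards [hs_pos, eventually_ge_atTop 1] with n h1 h2
    exact ⟨by exact_mod_cast h1, by exact_mod_cast h2⟩
  have hℓtop : Tendsto ℓ atTop atTop := by
    have h1 : Tendsto (fun n : ℕ => (s n : ℝ) / n) atTop (𝓝[>] 0) :=
      tendsto_nhdsWithin_iff.2 ⟨hs, hpos.mono fun n hn => div_pos hn.1 hn.2⟩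
    refine (Real.tendsto_log_atTop.comp h1.inv_tendsto_nhdsGT_zero).congr fun n => ?_
    simp [hℓ]
  have hratio : ∀ᶠ n : ℕ in atTop, (s n : ℝ) / n = Real.exp (-ℓ n) := by
    filter_upwards [hpos] with n hn
    rw [hℓ, ← Real.log_inv, inv_div, Real.exp_log (div_pos hn.1 hn.2)]
  have hb : ∀ᶠ n : ℕ in atTop, 0 < s n * ℓ n := by
    filter_upwards [hpos, hℓtop.eventually_gt_atTop 0] with n hn hn'
    exact mul_pos hn.1 hn'
  have hlower : ∀ᶠ n : ℕ in atTop, ENNReal.ofReal (Real.exp (-(s n * ℓ n))) ≤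
      P n (Set.Icc (((s n : ℝ) / n) ^ ((1 + ω / 2) / (α - 1)))
        (((s n : ℝ) / n) ^ (α / (α - 1)))) := by
    -- Of the convergence to 0 only an eventual bound by 1 is needed: the divergence of the tail
    -- ratio allows any multiple of sℓ to be lost here.
    filter_upwards [hb, Tendsto.eventually_lt_const (v := 0) (u := ((1 : ℝ) : EReal))
      (by exact_mod_cast one_pos) hmass] with n hn h1
    simpa using SparseMeans.ofReal_exp_le_of_negLog_div_lt hn h1
  have hupper : ∀ᶠ n : ℕ in atTop, P n (Set.Ici (((s n : ℝ) / n) ^ (α / (α - 1)))) ≤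
      ENNReal.ofReal (Real.exp (-(M * (s n * ℓ n)))) := by
    filter_upwards [hb, Tendsto.eventually_const_lt (v := ⊤) (u := (M : EReal))
      (EReal.coe_lt_top M) htail] with n hn h1
    exact SparseMeans.le_ofReal_exp_of_lt_negLog_div hn h1
  have hlim : Tendsto (fun n => ENNReal.ofReal (err (ℓ n))) atTop (𝓝 0) := by
    simpa using ENNReal.tendsto_ofReal (herr.comp hℓtop)
  have hbound : ∀ᶠ n : ℕ in atTop, ∀ A : Set (Fin n → ℝ),
      (∀ y θ : Fin n → ℝ, ∑ i ∈ S n, (y i - θstar n i) ^ 2 ≤ ω / 5 * ((S n).card * √(Real.log n) ^ 2) →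
        θ ∈ A → (2 + ω) * ((S n).card * √(Real.log n) ^ 2) ≤ ∑ i ∈ S n, (θ i - y i) ^ 2 ∨
        ω / 5 * ((S n).card * √(Real.log n) ^ 2) ≤
          ∑ i ∈ (S n)ᶜ, (√(Real.log n) * |θ i| + θ i ^ 2)) →
      SparseMeans.expectedPosterior π0 (P n) (θstar n) A ≤ ENNReal.ofReal (err (ℓ n)) := by
    filter_upwards [hℓtop.eventually hmain, hs_pos, hpos, hratio, hsupp, hlower, hupper]
      with n h1 h2 h3 h4 h5 h6 h7
    have := hP n
    rw [h4] at h6 h7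
    rw [div_eq_iff h3.2.ne'] at h4
    exact h1 n (S n) (θstar n) (P n) (by rw [hcard]; exact h2) (by rw [hcard]; exact h4)
      (hzero n) h5 (by rw [hcard]; exact h6) (by rw [hcard]; exact h7)
  have hlog : ∀ᶠ n : ℕ in atTop, 0 < Real.log n :=
    (Real.tendsto_log_atTop.comp tendsto_natCast_atTop_atTop).eventually_gt_atTop 0
  refine ⟨tendsto_of_tendsto_of_tendsto_of_le_of_le' tendsto_const_nhds hlim
    (Eventually.of_forall fun _ => zero_le) ?_,
    tendsto_of_tendsto_of_tendsto_of_le_of_le' tendsto_const_nhds hlim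
    (Eventually.of_forall fun _ => zero_le) ?_⟩
  · filter_upwards [hbound, hlog] with n h1 h2
    refine h1 _ fun y θ hy hθ => ?_
    by_contra! hcon
    have := SparseMeans.norm_two_lt hω (Real.sqrt_pos.2 h2) (hzero n) hy hcon.1 hcon.2
    rw [Real.sq_sqrt h2.le, hcard] at this
    exact absurd hθ (not_le.2 this)
  · filter_upwards [hbound, hlog] with n h1 h2
    refine h1 _ fun y θ hy hθ => ?_
    by_contra! hcon
    have := SparseMeans.norm_one_lt hω (Real.sqrt_pos.2 h2) (hzero n) hy hcon.1 hcon.2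
    rw [hcard] at this
    exact absurd hθ (not_le.2 this)
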